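/- Conventions. Let $S$ be a finite monoid which is a right regular band of groups, i.e. $S$ is regular ($\forall s\,\exists t:\ sts=s$) and every right ideal of $S$ is a two-sided ideal. Write $s\le_{\mathscr J}t$ if $SsS\subseteq StS$; the associated equivalence classes are the $\mathscr J$-classes $J_1,\dots,J_n$ of $S$, partially ordered by $\le_{\mathscr J}$. For each $i$ choose an idempotent $e_i\in J_i$ and let $G_i$ be the group of units of the monoid $e_iSe_i$. Let $E(J_\ell)$ be the set of idempotents in $J_\ell$, let $s^\omega$ be the unique idempotent among the powers $s^n$, $n\ge 1$, and let $\mu$ be the Möbius function of the poset of principal right ideals $sS$ of $S$ ordered by inclusion, with $\mu(J_m,J_i):=\mu(e_mS,e_iS)$. Let $k$ be an algebraically closed field of characteristic $0$. All modules are right modules. For a $kG_i$-module $V$ put $$\mathrm{Ind}_i(V)=V\otimes_{kG_i}e_i\bigl(kS/kI_i\bigr),\qquad I_i=\{s\in S: e_i\not\le_{\mathscr J}s\},$$ a right $kS$-module, and let $\chi_V(g)$ be the trace of $v\mapsto vg$ on $V$. For projective indecomposable $kS$-modules $P,Q$ the Cartan invariant is $C_{PQ}=\dim_k\mathrm{Hom}_{kS}(P,Q)$.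 Theorem 5.5. Let $V$ be a simple $kG_i$-module and $W$ a simple $kG_\ell$-module, and set $P=\mathrm{Ind}_i(V)$, $Q=\mathrm{Ind}_\ell(W)$. Then $P$ and $Q$ are projective indecomposable $kS$-modules, and $$C_{PQ}=\begin{cases}\ast & \text{if } J_i>_{\mathscr J}J_\ell,\\ 1 & \text{if } i=\ell \text{ and } V\cong W,\\ 0&\text{otherwise,}\end{cases}$$ where $$\ast=\frac1{|G_i|}\sum_{g\in G_i}\chi_V(g^{-1})\sum_{J_\ell\le_{\mathscr J}J_m\le_{\mathscr J}J_i}\mu(J_m,J_i)\sum_{\substack{e\in E(J_\ell)\\(ege_m)^\omega=e}}\chi_W(ege_\ell).$$ (In the last sum $ege_\ell$ is an element of $G_\ell$.) -/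

import Mathlib

open scoped TensorProduct
open MulOpposite (op)

noncomputable section

namespace RRBG

universe u v w

/-! ### Principal ideals, the `J`-order, right regular bands of groups -/

section Green

variable {S : Type u} [Monoid S]

/-- The principal right ideal `sS`. -/
def rightIdeal (s : S) : Set S := {x | ∃ a, x = s * a}

/-- The principal two-sided ideal `SsS`. -/
def twoSidedIdeal (s : S) : Set S := {x | ∃ a b, x = a * s * b}

/-- Green's preorder: `s ≤_J t` if and only if `SsS ⊆ StS`. -/
def JLe (s t : S) : Prop := twoSidedIdeal s ⊆ twoSidedIdeal t

/-- `s <_J t`. -/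
def JLt (s t : S) : Prop := JLe s t ∧ ¬ JLe t s

/-- Green's relation: `s J t` if and only if `SsS = StS`. -/
def JEquiv (s t : S) : Prop := twoSidedIdeal s = twoSidedIdeal t

variable (S) in
/-- A right regular band of groups: a regular semigroup (here: monoid) in which every right ideal
is a two-sided ideal. -/
structure IsRightRegularBandOfGroups : Prop where
  regular : ∀ s : S, ∃ t : S, s * t * s = s
  right_ideal_two_sided : ∀ R : Set S, (∀ r ∈ R, ∀ s : S, r * s ∈ R) → ∀ r ∈ R, ∀ s : S, s * r ∈ R

variable (S) in
/-- The poset of principal right ideals of `S`, ordered by inclusion. -/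
abbrev PrincipalRightIdeals : Type u := ↥(Set.range (rightIdeal : S → Set S))

/-- The principal right ideal `sS` as an element of the poset of principal right ideals. -/
def principal (s : S) : PrincipalRightIdeals S := ⟨rightIdeal s, s, rfl⟩

open Classical in
/-- The Möbius function `μ(sS, tS)` of the finite poset of principal right ideals of `S`. -/
def moebius [Finite S] (s t : S) : ℤ :=
  letI : Fintype (PrincipalRightIdeals S) := Fintype.ofFinite _
  letI : LocallyFiniteOrder (PrincipalRightIdeals S) := Fintype.toLocallyFiniteOrder
  IncidenceAlgebra.mu ℤ (principal s) (principal t)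

theorem exists_idempotent_pow [Finite S] (s : S) : ∃ n : ℕ, 0 < n ∧ IsIdempotentElem (s ^ n) := by
  obtain ⟨a, b, hab, h⟩ : ∃ a b : ℕ, a < b ∧ s ^ a = s ^ b := by
    obtain ⟨a, b, hne, h⟩ := Finite.exists_ne_map_eq_of_infinite (fun n : ℕ => s ^ n)
    rcases lt_or_gt_of_ne hne with h1 | h1
    · exact ⟨a, b, h1, h⟩
    · exact ⟨b, a, h1, h.symm⟩
  obtain ⟨p, rfl⟩ := Nat.exists_eq_add_of_lt hab
  have step : ∀ m, a ≤ m → s ^ (m + (p + 1)) = s ^ m := by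
    intro m hm
    obtain ⟨c, rfl⟩ := Nat.exists_eq_add_of_le hm
    rw [show a + c + (p + 1) = (a + p + 1) + c by omega, pow_add, ← h, ← pow_add]
  have steps : ∀ j m, a ≤ m → s ^ (m + j * (p + 1)) = s ^ m := by
    intro j
    induction j with
    | zero => intro m _; simp
    | succ j ih =>
      intro m hm
      rw [show m + (j + 1) * (p + 1) = (m + j * (p + 1)) + (p + 1) by ring,
        step _ (le_trans hm (Nat.le_add_right _ _)), ih m hm]
  refine ⟨(a + 1) * (p + 1), by positivity, ?_⟩
  unfold IsIdempotentElem
  rw [← pow_add, steps]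
  nlinarith

/-- `s ^ ω`: the (unique) idempotent power of `s` with positive exponent. -/
def omegaPow [Finite S] (s : S) : S := s ^ (exists_idempotent_pow s).choose

theorem omegaPow_eq_iff [Finite S] (s e : S) :
    omegaPow s = e ↔ IsIdempotentElem e ∧ ∃ n : ℕ, 0 < n ∧ s ^ n = e := by
  have hspec := (exists_idempotent_pow s).choose_spec
  constructor
  · rintro rfl
    exact ⟨hspec.2, _, hspec.1, rfl⟩
  · rintro ⟨he, n, hn, rfl⟩
    have h1 := he.pow_eq hspec.1.ne'
    have h2 := hspec.2.pow_eq hn.ne'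
    rw [← pow_mul] at h1 h2
    rw [omegaPow, ← h2, ← h1, mul_comm]

variable (S) in
/-- The set `E(S)` of idempotents of `S`. -/
abbrev Idem : Type u := {e : S // IsIdempotentElem e}

/-- The monoid `eSe`, with identity `e`, for an idempotent `e`. -/
def LocalMonoid (e : Idem S) : Type u := {x : S // e.1 * x = x ∧ x * e.1 = x}

instance (e : Idem S) : Monoid (LocalMonoid e) where
  mul x y := ⟨x.1 * y.1, by rw [← mul_assoc, x.2.1], by rw [mul_assoc, y.2.2]⟩
  one := ⟨e.1, e.2, e.2⟩
  mul_assoc x y z := Subtype.ext (mul_assoc x.1 y.1 z.1)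
  one_mul x := Subtype.ext x.2.1
  mul_one x := Subtype.ext x.2.2

instance [Finite S] (e : Idem S) : Finite (LocalMonoid e) := Subtype.finite

/-- The maximal subgroup `G_e` of `S` at the idempotent `e`: the group of units of `eSe`. -/
abbrev MaxSubgroup (e : Idem S) : Type u := (LocalMonoid e)ˣ

instance [Finite S] (e : Idem S) : Fintype (MaxSubgroup e) := Fintype.ofFinite _

/-- The element of `S` underlying an element of the maximal subgroup at `e`. -/
def MaxSubgroup.toS {e : Idem S} (g : MaxSubgroup e) : S := g.val.1

theorem MaxSubgroup.toS_mul {e : Idem S} (g h : MaxSubgroup e) :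
    (g * h).toS = g.toS * h.toS := rfl

theorem MaxSubgroup.toS_one {e : Idem S} : (1 : MaxSubgroup e).toS = e.1 := rfl

/-- The idempotents `e 1, …, e n` form a set of representatives of the `J`-classes of `S`. -/
def IsJTransversal {n : ℕ} (e : Fin n → Idem S) : Prop :=
  ∀ s : S, ∃! i : Fin n, JEquiv s (e i).1

end Green

/-! ### Right modules and Cartan invariants

Right modules over a ring `A` are modules over `Aᵐᵒᵖ`; thus `op a • m` is `m · a`. -/

section Modules

/-- A right `A`-module is a projective indecomposable module. -/
structure IsProjectiveIndecomposable (A : Type u) [Ring A] (P : Type v) [AddCommGroup P]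
    [Module Aᵐᵒᵖ P] : Prop where
  projective : Module.Projective Aᵐᵒᵖ P
  nontrivial : Nontrivial P
  indecomposable : ∀ N N' : Submodule Aᵐᵒᵖ P, IsCompl N N' → N = ⊥ ∨ N' = ⊥

/-- The Cartan invariant `C_{PQ} = dim Hom_A(P, Q)` of two (projective indecomposable) right
modules over a `k`-algebra `A`. -/
def cartanInvariant (k : Type u) [Field k] (A : Type v) [Ring A] [Algebra k A]
    (P : Type*) (Q : Type*) [AddCommGroup P] [AddCommGroup Q] [Module Aᵐᵒᵖ P] [Module Aᵐᵒᵖ Q]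
    [Module k Q] [IsScalarTower k Aᵐᵒᵖ Q] : ℕ :=
  Module.finrank k (P →ₗ[Aᵐᵒᵖ] Q)

end Modules

/-! ### The induced modules -/

section Induced

variable (k : Type v) [Field k] {S : Type u} [Monoid S]

/-- The right ideal `e kS` of `kS`. -/
def cornerIdeal (e : Idem S) : Submodule (MonoidAlgebra k S)ᵐᵒᵖ (MonoidAlgebra k S) :=
  Submodule.span _ {MonoidAlgebra.single e.1 1}

/-- The ideal `kI` of `kS`, where `I = {s | ¬ e ≤_J s}`, viewed as a right ideal. As `I` is an
ideal of `S`, the right ideal generated by `I` is the `k`-span of `I`. -/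
def notUpIdeal (e : Idem S) : Submodule (MonoidAlgebra k S)ᵐᵒᵖ (MonoidAlgebra k S) :=
  Submodule.span _ {x | ∃ s : S, ¬ JLe e.1 s ∧ x = MonoidAlgebra.single s 1}

/-- The `kG_e`-`kS`-bimodule `e(kS/kI) = ekS/(ekS ∩ kI)`, where `I = {s | ¬ e ≤_J s}`. -/
def IndBimodule (e : Idem S) : Type (max u v) :=
  ↥(cornerIdeal k e) ⧸ (notUpIdeal k e).submoduleOf (cornerIdeal k e)

instance (e : Idem S) : AddCommGroup (IndBimodule k e) :=
  inferInstanceAs (AddCommGroup (↥(cornerIdeal k e) ⧸ (notUpIdeal k e).submoduleOf _))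

/-- The right action of `kS` on `e(kS/kI)`. -/
instance (e : Idem S) : Module (MonoidAlgebra k S)ᵐᵒᵖ (IndBimodule k e) :=
  inferInstanceAs (Module _ (↥(cornerIdeal k e) ⧸ (notUpIdeal k e).submoduleOf _))

instance (e : Idem S) : Module k (IndBimodule k e) :=
  inferInstanceAs (Module k (↥(cornerIdeal k e) ⧸ (notUpIdeal k e).submoduleOf _))

instance (e : Idem S) : IsScalarTower k (MonoidAlgebra k S)ᵐᵒᵖ (IndBimodule k e) :=
  inferInstanceAs (IsScalarTower k _ (↥(cornerIdeal k e) ⧸ (notUpIdeal k e).submoduleOf _))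

variable {k} in
theorem mem_cornerIdeal_iff {e : Idem S} {x : MonoidAlgebra k S} :
    x ∈ cornerIdeal k e ↔ MonoidAlgebra.single e.1 1 * x = x := by
  rw [cornerIdeal, Submodule.mem_span_singleton]
  constructor
  · rintro ⟨a, rfl⟩
    rw [MulOpposite.smul_eq_mul_unop, ← mul_assoc, MonoidAlgebra.single_mul_single, e.2.eq, mul_one]
  · intro h
    exact ⟨op x, by rw [MulOpposite.smul_eq_mul_unop]; exact h⟩

/-- Left multiplication by an element of `G_e` on `kS`. -/
def leftMulS {e : Idem S} (g : MaxSubgroup e) :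
    Module.End (MonoidAlgebra k S)ᵐᵒᵖ (MonoidAlgebra k S) :=
  Module.toModuleEnd _ _ (MonoidAlgebra.single g.toS (1 : k) : MonoidAlgebra k S)

theorem leftMulS_apply {e : Idem S} (g : MaxSubgroup e) (x : MonoidAlgebra k S) :
    leftMulS k g x = MonoidAlgebra.single g.toS 1 * x := rfl

theorem leftMulS_mem {e : Idem S} (g : MaxSubgroup e) (x : MonoidAlgebra k S)
    (_hx : x ∈ cornerIdeal k e) : leftMulS k g x ∈ cornerIdeal k e := by
  rw [mem_cornerIdeal_iff, leftMulS_apply, ← mul_assoc, MonoidAlgebra.single_mul_single, mul_one,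
    show e.1 * g.toS = g.toS from g.val.2.1]

theorem leftMulS_mem_notUp {e : Idem S} (g : MaxSubgroup e) (x : MonoidAlgebra k S)
    (hx : x ∈ notUpIdeal k e) : leftMulS k g x ∈ notUpIdeal k e := by
  have : notUpIdeal k e ≤ (notUpIdeal k e).comap (leftMulS k g) := by
    refine Submodule.span_le.2 ?_
    rintro _ ⟨s, hs, rfl⟩
    refine Submodule.subset_span ⟨g.toS * s, fun h => hs (h.trans ?_), ?_⟩
    · rintro _ ⟨a, b, rfl⟩
      exact ⟨a * g.toS, b, by simp only [mul_assoc]⟩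
    · rw [leftMulS_apply, MonoidAlgebra.single_mul_single, mul_one]
  exact this hx

/-- Left multiplication by an element of `G_e` on `e(kS/kI)`, as an endomorphism of right
`kS`-modules. -/
def leftMul {e : Idem S} (g : MaxSubgroup e) :
    Module.End (MonoidAlgebra k S)ᵐᵒᵖ (IndBimodule k e) :=
  Submodule.mapQ ((notUpIdeal k e).submoduleOf (cornerIdeal k e))
    ((notUpIdeal k e).submoduleOf (cornerIdeal k e))
    ((leftMulS k g).restrict (leftMulS_mem k g)) (fun x hx => leftMulS_mem_notUp k g x hx)

/-- Left multiplication as a homomorphism from `G_e` to the endomorphisms of the right `kS`-module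
`e(kS/kI)`. -/
def leftMulHom (e : Idem S) :
    MaxSubgroup e →* Module.End (MonoidAlgebra k S)ᵐᵒᵖ (IndBimodule k e) where
  toFun := leftMul k
  map_one' := by
    ext x
    obtain ⟨x, rfl⟩ := Submodule.Quotient.mk_surjective _ x
    refine congrArg (Submodule.Quotient.mk) (Subtype.ext ?_)
    exact mem_cornerIdeal_iff.1 x.2
  map_mul' g h := by
    ext x
    obtain ⟨x, rfl⟩ := Submodule.Quotient.mk_surjective _ x
    refine congrArg (Submodule.Quotient.mk) (Subtype.ext ?_)
    change MonoidAlgebra.single _ 1 * x.1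
      = MonoidAlgebra.single _ 1 * (MonoidAlgebra.single _ 1 * x.1)
    rw [← mul_assoc, MonoidAlgebra.single_mul_single, mul_one, MaxSubgroup.toS_mul]

/-- The left action of `kG_e` on `e(kS/kI)`, by left multiplication. -/
instance (e : Idem S) : Module (MonoidAlgebra k (MaxSubgroup e)) (IndBimodule k e) :=
  Module.compHom _ (MonoidAlgebra.lift k
    (Module.End (MonoidAlgebra k S)ᵐᵒᵖ (IndBimodule k e)) (MaxSubgroup e) (leftMulHom k e)).toRingHom

/-- The projection `ekS → e(kS/kI)`. -/
def IndBimodule.mk (e : Idem S) : cornerIdeal k e →ₗ[(MonoidAlgebra k S)ᵐᵒᵖ] IndBimodule k e :=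
  Submodule.mkQ _

theorem single_smul_mk {e : Idem S} (g : MaxSubgroup e) (x : cornerIdeal k e) :
    (MonoidAlgebra.single g 1 : MonoidAlgebra k (MaxSubgroup e)) • IndBimodule.mk k e x =
      IndBimodule.mk k e ⟨MonoidAlgebra.single g.toS 1 * x.1, leftMulS_mem k g x.1 x.2⟩ := by
  change (MonoidAlgebra.lift k (Module.End (MonoidAlgebra k S)ᵐᵒᵖ (IndBimodule k e))
    (MaxSubgroup e) (leftMulHom k e)) (MonoidAlgebra.single g 1) (IndBimodule.mk k e x) = _
  rw [MonoidAlgebra.lift_single, one_smul]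
  rfl

/-- The tensor product `V ⊗_B M` over a (noncommutative) `k`-algebra `B` of a right `B`-module `V`
and a `B`-`A`-bimodule `M`, as a right `A`-module: the quotient of the tensor product over `k` by
the relations `v · b ⊗ m = v ⊗ b · m`. The factors are written in the opposite order, so that the
right `A`-module structure is the one that Mathlib puts on a tensor product through its first
factor. -/
def BalancedTensor (B : Type*) (A : Type*) (V : Type*) (M : Type*) [Ring B] [Algebra k B] [Ring A]
    [Algebra k A] [AddCommGroup V] [Module k V] [Module Bᵐᵒᵖ V] [AddCommGroup M] [Module k M]
    [Module B M] [Module Aᵐᵒᵖ M] [IsScalarTower k Aᵐᵒᵖ M] : Type _ :=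
  (M ⊗[k] V) ⧸ (Submodule.span Aᵐᵒᵖ
    {z : M ⊗[k] V | ∃ (v : V) (b : B) (m : M), z = m ⊗ₜ[k] (op b • v) - (b • m) ⊗ₜ[k] v})

section

variable (B : Type*) (A : Type*) (V : Type*) (M : Type*) [Ring B] [Algebra k B] [Ring A]
    [Algebra k A] [AddCommGroup V] [Module k V] [Module Bᵐᵒᵖ V] [AddCommGroup M] [Module k M]
    [Module B M] [Module Aᵐᵒᵖ M] [IsScalarTower k Aᵐᵒᵖ M]

instance : AddCommGroup (BalancedTensor k B A V M) :=
  inferInstanceAs (AddCommGroup ((M ⊗[k] V) ⧸ (Submodule.span Aᵐᵒᵖ _)))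

instance : Module Aᵐᵒᵖ (BalancedTensor k B A V M) :=
  inferInstanceAs (Module Aᵐᵒᵖ ((M ⊗[k] V) ⧸ (Submodule.span Aᵐᵒᵖ _)))

instance : Module k (BalancedTensor k B A V M) :=
  inferInstanceAs (Module k ((M ⊗[k] V) ⧸ (Submodule.span Aᵐᵒᵖ _)))

instance : IsScalarTower k Aᵐᵒᵖ (BalancedTensor k B A V M) :=
  inferInstanceAs (IsScalarTower k Aᵐᵒᵖ ((M ⊗[k] V) ⧸ (Submodule.span Aᵐᵒᵖ _)))

end

variable (e : Idem S) (V : Type w) [AddCommGroup V] [Module k V]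
  [Module (MonoidAlgebra k (MaxSubgroup e))ᵐᵒᵖ V]

/-- The induced right `kS`-module `Ind_e(V) = V ⊗_{kG_e} e(kS/kI)` of a right `kG_e`-module `V`,
where `I = {s | ¬ e ≤_J s}`. -/
abbrev Ind : Type _ :=
  BalancedTensor k (MonoidAlgebra k (MaxSubgroup e)) (MonoidAlgebra k S) V (IndBimodule k e)

variable [IsScalarTower k (MonoidAlgebra k (MaxSubgroup e))ᵐᵒᵖ V]

/-- The character `χ_V` of a right `kG_e`-module `V`: `χ_V(g)` is the trace of `v ↦ v · g`. -/
def character (g : MaxSubgroup e) : k :=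
  LinearMap.trace k V (Algebra.lsmul k k V
    (op (MonoidAlgebra.single g 1 : MonoidAlgebra k (MaxSubgroup e))))

open Classical in
/-- The character `χ_V` as a function of elements of `S`: the value at `s` is `χ_V(s)` if
`s ∈ G_e`, and `0` otherwise. -/
def characterS (s : S) : k :=
  if h : ∃ g : MaxSubgroup e, g.toS = s then character k e V h.choose else 0

theorem characterS_toS (g : MaxSubgroup e) : characterS k e V g.toS = character k e V g := by
  have h : ∃ g' : MaxSubgroup e, g'.toS = g.toS := ⟨g, rfl⟩
  have h2 : h.choose = g := Units.ext (Subtype.ext h.choose_spec)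
  rw [characterS, dif_pos h, h2]

end Induced

/-- In a finite right regular band of groups, `f g e_ℓ` lies in the maximal subgroup at `e_ℓ`
whenever `f` is an idempotent in the `J`-class of `e_ℓ` and `g` belongs to a maximal subgroup at an
idempotent `e_i` with `e_ℓ ≤_J e_i`. -/
theorem exists_toS_eq {S : Type u} [Monoid S] [Finite S] (hS : IsRightRegularBandOfGroups S)
    (ei el : Idem S) (hle : JLe el.1 ei.1) (g : MaxSubgroup ei) (f : S)
    (hf : JEquiv f el.1) : ∃ h : MaxSubgroup el, h.toS = f * g.toS * el.1 := by
  have ideal : ∀ a x s : S, x ∈ rightIdeal a → s * x ∈ rightIdeal a := fun a x s hx =>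
    hS.right_ideal_two_sided (rightIdeal a)
      (by rintro _ ⟨c, rfl⟩ t; exact ⟨c * t, mul_assoc _ _ _⟩) x hx s
  have hself : ∀ a : S, a ∈ rightIdeal a := fun a => ⟨1, (mul_one a).symm⟩
  have two : ∀ a x : S, x ∈ twoSidedIdeal a → x ∈ rightIdeal a := by
    rintro a _ ⟨c, d, rfl⟩
    obtain ⟨t, ht⟩ := ideal a a c (hself a)
    exact ⟨t * d, by rw [ht, mul_assoc]⟩
  have hmul : ∀ a b y : S, y ∈ rightIdeal a → y ∈ rightIdeal b → y ∈ rightIdeal (a * b) := by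
    rintro a b y ⟨u, rfl⟩ hb
    obtain ⟨a', ha'⟩ := hS.regular a
    obtain ⟨t, ht⟩ := ideal b _ a' hb
    refine ⟨t, ?_⟩
    rw [mul_assoc, ← ht, ← mul_assoc, ← mul_assoc, ha']
  have hmem2 : ∀ a : S, a ∈ twoSidedIdeal a := fun a => ⟨1, 1, by simp⟩
  have h1 : el.1 ∈ rightIdeal f := two _ _ (by rw [hf]; exact hmem2 _)
  have h2 : el.1 ∈ rightIdeal g.toS := by
    obtain ⟨t, ht⟩ := two _ _ (hle (hmem2 _))
    refine ⟨(g⁻¹).toS * t, ?_⟩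
    rw [← mul_assoc, ← MaxSubgroup.toS_mul, mul_inv_cancel, MaxSubgroup.toS_one, ← ht]
  obtain ⟨t, ht⟩ := hmul _ _ _ (hmul _ _ _ h1 h2) (hself el.1)
  have hx1 : el.1 * (f * g.toS * el.1) = f * g.toS * el.1 := by
    obtain ⟨c, hc⟩ := ideal el.1 el.1 (f * g.toS) (hself _)
    rw [hc, ← mul_assoc, el.2.eq]
  have hx2 : f * g.toS * el.1 * el.1 = f * g.toS * el.1 := by rw [mul_assoc, el.2.eq]
  let x : LocalMonoid el := ⟨f * g.toS * el.1, hx1, hx2⟩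
  let y : LocalMonoid el := ⟨el.1 * t * el.1, by rw [← mul_assoc, ← mul_assoc, el.2.eq],
    by rw [mul_assoc, el.2.eq]⟩
  have hxy : x * y = 1 := Subtype.ext (by
    change f * g.toS * el.1 * (el.1 * t * el.1) = el.1
    rw [← mul_assoc, ← mul_assoc, hx2, ← ht, el.2.eq])
  have hyx : y * x = 1 := by
    have hinj : Function.Injective (fun z : LocalMonoid el => y * z) := fun z z' h => by
      have h' := congrArg (x * ·) h
      simpa only [← mul_assoc, hxy, one_mul] using h'
    obtain ⟨z, hz⟩ := Finite.surjective_of_injective hinj 1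
    have hz' : y * z = 1 := hz
    have : x = z := by rw [← mul_one x, ← hz', ← mul_assoc, hxy, one_mul]
    rw [this, hz']
  exact ⟨⟨x, y, hxy, hyx⟩, rfl⟩

/-! ### The Cartan matrix formula -/

open Classical in
/-- The character formula
`1/|G_i| ∑_{g ∈ G_i} χ_V(g⁻¹) ∑_{J_ℓ ≤ J_m ≤ J_i} μ(J_m, J_i)
  ∑_{f ∈ E(J_ℓ), (f g e_m)^ω = f} χ_W(f g e_ℓ)`. -/
def cartanFormula (k : Type v) [Field k] {S : Type u} [Monoid S] [Fintype S] {n : ℕ}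
    (e : Fin n → Idem S) (i l : Fin n)
    (V : Type*) [AddCommGroup V] [Module k V] [Module (MonoidAlgebra k (MaxSubgroup (e i)))ᵐᵒᵖ V]
    [IsScalarTower k (MonoidAlgebra k (MaxSubgroup (e i)))ᵐᵒᵖ V]
    (W : Type*) [AddCommGroup W] [Module k W] [Module (MonoidAlgebra k (MaxSubgroup (e l)))ᵐᵒᵖ W]
    [IsScalarTower k (MonoidAlgebra k (MaxSubgroup (e l)))ᵐᵒᵖ W] : k :=
  (1 / (Nat.card (MaxSubgroup (e i)) : k)) *
    ∑ g : MaxSubgroup (e i), character k (e i) V g⁻¹ *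
      ∑ m : Fin n with JLe (e l).1 (e m).1 ∧ JLe (e m).1 (e i).1,
        (moebius (e m).1 (e i).1 : k) *
          ∑ f : S with IsIdempotentElem f ∧ JEquiv f (e l).1 ∧
              omegaPow (f * g.toS * (e m).1) = f,
            characterS k (e l) W (f * g.toS * (e l).1)

/-- The pairs `(i, V)` and `(ℓ, W)` agree: `i = ℓ` and `V ≅ W` as right modules over the group
algebra of `G_i = G_ℓ`. -/
def SameModule (k : Type v) [Field k] {S : Type u} [Monoid S] {n : ℕ}
    (e : Fin n → Idem S) (i l : Fin n)
    (V : Type*) [AddCommGroup V] [Module k V] [Module (MonoidAlgebra k (MaxSubgroup (e i)))ᵐᵒᵖ V]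
    (W : Type*) [AddCommGroup W] [Module k W]
    [Module (MonoidAlgebra k (MaxSubgroup (e l)))ᵐᵒᵖ W] : Prop :=
  i = l ∧ ∃ φ : V ≃ₗ[k] W, ∀ (g : MaxSubgroup (e i)) (h : MaxSubgroup (e l)), g.toS = h.toS →
    ∀ v : V, φ (op (MonoidAlgebra.single g (1 : k)) • v) =
      op (MonoidAlgebra.single h (1 : k)) • φ v

end RRBG

end

open RRBG

/-! Call η in kS a splitting at e_i if ηe_i = η, ηI_i = 0 and η - e_i lies in kI_i; one exists for
each i (`exists_isSplitting`). For a right module N, right multiplication by η projects N onto N_i =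
{n : ne_i = n, nI_i = 0}, and Hom_{kS}(Ind_i(V), N) is Hom_{kG_i}(V, N_i) (`homEquiv`). Combining η
with averaging over G_i projects Hom_k(V, N) onto that space (`averageHom`). This projection is
natural in N, so Ind_i(V) is projective (`projective_ind`). Its trace gives dim Hom(Ind_i(V), N) as
the average over g of χ_V(g⁻¹) tr_N(ηg) (`finrank_hom_eq`).

Möbius inversion removes η from the trace. Every trace function τ on kS satisfies τ(s) = ∑_j τ(η_j
s) (`trace_eq_sum`). Replacing s by s e_m keeps exactly the terms with J_j ≤ J_m, so τ(ηs) = ∑_m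
μ(J_m, J_i) τ(s e_m) (`trace_splitting_eq`). The traces on N = Ind_ℓ(W) are explicit: as a vector
space N is a sum of copies of W indexed by E(J_ℓ). If e_ℓ ≤ s, then s sends the copy at f to the
copy at (fs)^ω, twisted by an element of G_ℓ; otherwise s acts by zero (`actionTrace_ind`).

For i = ℓ the space N_i is W itself, so Schur's lemma applies (`finrank_hom_ind`); the case V = W
gives a one-dimensional endomorphism algebra and hence indecomposability. If e_ℓ ≰ e_i, then e_i
annihilates Ind_ℓ(W) and no nonzero map exists (`finrank_hom_ind_of_not_jle`). -/

noncomputable section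
namespace RRBG
universe u v w

/-! ### The J-order, ω-powers and maximal subgroups. -/

section RightIdeals

variable {S : Type u} [Monoid S]

theorem JLe.refl (s : S) : JLe s s := Set.Subset.refl _

theorem JLe.trans {s t r : S} (h : JLe s t) (h' : JLe t r) : JLe s r := Set.Subset.trans h h'

theorem jequiv_iff {s t : S} : JEquiv s t ↔ JLe s t ∧ JLe t s :=
  Set.Subset.antisymm_iff

theorem mul_jle_left (s t : S) : JLe (s * t) s := by
  rintro _ ⟨a, b, rfl⟩
  exact ⟨a, t * b, by simp only [mul_assoc]⟩

theorem mul_jle_right (s t : S) : JLe (s * t) t := by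
  rintro _ ⟨a, b, rfl⟩
  exact ⟨a * s, b, by simp only [mul_assoc]⟩

namespace IsRightRegularBandOfGroups

/-- The right ideal aS is two-sided. The arguments below use that hypothesis on S only in this form.
-/
theorem exists_mul_eq (hS : IsRightRegularBandOfGroups S) (a s : S) : ∃ t, s * a = a * t :=
  hS.right_ideal_two_sided (rightIdeal a)
    (by rintro _ ⟨c, rfl⟩ t; exact ⟨c * t, mul_assoc _ _ _⟩) a ⟨1, (mul_one a).symm⟩ s

theorem jle_iff_exists (hS : IsRightRegularBandOfGroups S) {s t : S} :
    JLe s t ↔ ∃ a, s = t * a := by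
  constructor
  · intro h
    obtain ⟨c, d, hcd⟩ := h (show s ∈ twoSidedIdeal s from ⟨1, 1, by simp⟩)
    obtain ⟨x, hx⟩ := hS.exists_mul_eq t c
    exact ⟨x * d, by rw [hcd, hx, mul_assoc]⟩
  · rintro ⟨a, rfl⟩
    exact mul_jle_left _ _

theorem jle_idem_iff (hS : IsRightRegularBandOfGroups S) {s e : S} (he : IsIdempotentElem e) :
    JLe s e ↔ e * s = s := by
  rw [hS.jle_iff_exists]
  constructor
  · rintro ⟨a, rfl⟩
    rw [← mul_assoc, he.eq]
  · intro h
    exact ⟨s, h.symm⟩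

/-- If s lies in aS and in bS, choose a' with aa'a = a. Then s = a(a's), and a's is again in the
two-sided ideal bS, so s is in abS. Consequently the elements above a given one form a submonoid. -/
theorem jle_mul_iff (hS : IsRightRegularBandOfGroups S) {s a b : S} : JLe s (a * b)
    ↔ JLe s a ∧ JLe s b := by
  constructor
  · intro h
    exact ⟨h.trans (mul_jle_left _ _), h.trans (mul_jle_right _ _)⟩
  · rintro ⟨ha, hb⟩
    obtain ⟨u, rfl⟩ := hS.jle_iff_exists.1 ha
    obtain ⟨a', ha'⟩ := hS.regular a
    obtain ⟨c, hc⟩ := hS.jle_iff_exists.1 hb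
    obtain ⟨t, ht⟩ := hS.exists_mul_eq b a'
    refine hS.jle_iff_exists.2 ⟨t * c, ?_⟩
    calc a * u = a * (a' * (a * u)) := by rw [← mul_assoc, ← mul_assoc, ha']
      _ = a * b * (t * c) := by rw [hc, ← mul_assoc a', ht]; simp only [mul_assoc]

theorem jle_pow (hS : IsRightRegularBandOfGroups S) {s t : S} (h : JLe s t) (n : ℕ) :
    JLe s (t ^ n) := by
  induction n with
  | zero => exact hS.jle_iff_exists.2 ⟨s, by simp⟩
  | succ n ih => rw [pow_succ]; exact hS.jle_mul_iff.2 ⟨ih, h⟩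

theorem rightIdeal_eq_twoSidedIdeal (hS : IsRightRegularBandOfGroups S) (s : S) :
    rightIdeal s = twoSidedIdeal s := by
  ext x
  constructor
  · rintro ⟨a, rfl⟩
    exact ⟨1, a, by simp⟩
  · rintro ⟨c, d, rfl⟩
    obtain ⟨x, hx⟩ := hS.exists_mul_eq s c
    exact ⟨x * d, by rw [hx, mul_assoc]⟩

end IsRightRegularBandOfGroups

theorem omegaPow_isIdempotentElem [Finite S] (s : S) : IsIdempotentElem (omegaPow s) :=
  ((omegaPow_eq_iff s _).1 rfl).1

theorem exists_omegaPow_eq_pow [Finite S] (s : S) : ∃ n : ℕ, 0 < n ∧ s ^ n = omegaPow s :=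
  ((omegaPow_eq_iff s _).1 rfl).2

theorem MaxSubgroup.toS_injective {e : Idem S} :
    Function.Injective (MaxSubgroup.toS : MaxSubgroup e → S) :=
  fun _ _ h => Units.ext (Subtype.ext h)

theorem MaxSubgroup.mul_toS {e : Idem S} (g : MaxSubgroup e) : e.1 * g.toS = g.toS := g.val.2.1

theorem MaxSubgroup.toS_mul_idem {e : Idem S} (g : MaxSubgroup e) : g.toS * e.1 = g.toS :=
  g.val.2.2

theorem MaxSubgroup.toS_jle {e : Idem S} (g : MaxSubgroup e) : JLe g.toS e.1 := by
  rw [← g.mul_toS]; exact mul_jle_left _ _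

theorem MaxSubgroup.jle_toS {e : Idem S} (g : MaxSubgroup e) : JLe e.1 g.toS := by
  have h : e.1 = g.toS * g⁻¹.toS := by
    rw [← MaxSubgroup.toS_mul, mul_inv_cancel, MaxSubgroup.toS_one]
  rw [h]; exact mul_jle_left _ _

namespace IsRightRegularBandOfGroups

theorem omegaPow_jequiv (hS : IsRightRegularBandOfGroups S) [Finite S] (s : S) :
    JEquiv (omegaPow s) s := by
  obtain ⟨n, hn, h⟩ := exists_omegaPow_eq_pow s
  rw [jequiv_iff, ← h]
  refine ⟨?_, hS.jle_pow (JLe.refl s) n⟩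
  obtain ⟨m, rfl⟩ := Nat.exists_eq_succ_of_ne_zero hn.ne'
  rw [Nat.succ_eq_add_one, pow_succ]
  exact mul_jle_right _ _

/-- As s ≤ s^ω and s^ω is idempotent, s^ω is a left identity for s; it commutes with s, being a
power of s. -/
theorem mul_omegaPow (hS : IsRightRegularBandOfGroups S) [Finite S] (s : S) :
    s * omegaPow s = s := by
  obtain ⟨n, hn, h⟩ := exists_omegaPow_eq_pow s
  have h1 := (hS.jle_idem_iff (omegaPow_isIdempotentElem s)).1
    (jequiv_iff.1 (hS.omegaPow_jequiv s)).2
  rw [← h] at h1 ⊢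
  rw [← pow_succ', pow_succ, h1]

/-- The product (xy)^ω y^ω equals (xy)^ω because y y^ω = y, and equals y^ω because y^ω ≤ (xy)^ω.
Thus the ω-power is constant on the orbits of left multiplication by G_e on the J-class of e. -/
theorem omegaPow_mul (hS : IsRightRegularBandOfGroups S) [Finite S] {x y : S} (h : JEquiv x y) :
    omegaPow (x * y) = omegaPow y := by
  obtain ⟨n, hn, hxy⟩ := exists_omegaPow_eq_pow (x * y)
  have h1 : omegaPow (x * y) * omegaPow y = omegaPow (x * y) := by
    obtain ⟨m, rfl⟩ := Nat.exists_eq_succ_of_ne_zero hn.ne'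
    rw [← hxy, Nat.succ_eq_add_one, pow_succ, mul_assoc, mul_assoc, hS.mul_omegaPow]
  have h2 : JLe (omegaPow y) (omegaPow (x * y)) :=
    (jequiv_iff.1 (hS.omegaPow_jequiv y)).1.trans
      ((hS.jle_mul_iff.2 ⟨(jequiv_iff.1 h).2, JLe.refl y⟩).trans
        (jequiv_iff.1 (hS.omegaPow_jequiv _)).2)
  rw [← h1]
  exact (hS.jle_idem_iff (omegaPow_isIdempotentElem _)).1 h2

/-- The element se is in eS, hence in eSe, and e ≤ se supplies a right inverse there. In a finite
monoid it is two-sided. -/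
theorem exists_toS_eq_mul_idem (hS : IsRightRegularBandOfGroups S) [Finite S] {e : Idem S}
    {s : S} (h : JLe e.1 s) :
    ∃ g : MaxSubgroup e, g.toS = s * e.1 := by
  obtain ⟨c, hc⟩ := hS.exists_mul_eq e.1 s
  let x : LocalMonoid e := ⟨s * e.1, by rw [hc, ← mul_assoc, e.2.eq], by rw [mul_assoc, e.2.eq]⟩
  obtain ⟨t, ht⟩ := hS.jle_iff_exists.1 (hS.jle_mul_iff.2 ⟨h, JLe.refl e.1⟩)
  let y : LocalMonoid e := ⟨e.1 * t * e.1, by rw [← mul_assoc, ← mul_assoc, e.2.eq],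
    by rw [mul_assoc, e.2.eq]⟩
  have hxy : x * y = 1 := Subtype.ext (by
    change s * e.1 * (e.1 * t * e.1) = e.1
    calc s * e.1 * (e.1 * t * e.1) = s * (e.1 * e.1) * t * e.1 := by simp only [mul_assoc]
      _ = e.1 := by rw [e.2.eq, ← ht, e.2.eq])
  exact ⟨⟨x, y, hxy, mul_eq_one_comm.1 hxy⟩, rfl⟩

end IsRightRegularBandOfGroups

open Classical in
/-- The element `se` of `G_e`, for `e ≤_J s` (with the value `1` if `e ≰_J s`). -/
def toMaxSubgroup (e : Idem S) (s : S) : MaxSubgroup e :=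
  if h : ∃ g : MaxSubgroup e, g.toS = s * e.1 then h.choose else 1

namespace IsRightRegularBandOfGroups

variable [Finite S]

theorem toS_toMaxSubgroup (hS : IsRightRegularBandOfGroups S) {e : Idem S} {s : S} (h : JLe e.1 s) :
    (toMaxSubgroup e s).toS = s * e.1 := by
  have h' := hS.exists_toS_eq_mul_idem h
  rw [toMaxSubgroup, dif_pos h', h'.choose_spec]

theorem toMaxSubgroup_toS (hS : IsRightRegularBandOfGroups S) {e : Idem S} (g : MaxSubgroup e) :
    toMaxSubgroup e g.toS = g :=
  MaxSubgroup.toS_injective (by rw [hS.toS_toMaxSubgroup g.jle_toS, g.toS_mul_idem])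

/-- Since te is in eSe, s(te) = (se)(te): right multiplication by e is a homomorphism from the
submonoid {s : e ≤ s} to G_e. -/
theorem toMaxSubgroup_mul (hS : IsRightRegularBandOfGroups S) {e : Idem S} {s t : S}
    (hs : JLe e.1 s) (ht : JLe e.1 t) :
    toMaxSubgroup e (s * t) = toMaxSubgroup e s * toMaxSubgroup e t := by
  refine MaxSubgroup.toS_injective ?_
  rw [hS.toS_toMaxSubgroup (hS.jle_mul_iff.2 ⟨hs, ht⟩), MaxSubgroup.toS_mul,
    hS.toS_toMaxSubgroup hs, mul_assoc, mul_assoc, MaxSubgroup.mul_toS, hS.toS_toMaxSubgroup ht]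

theorem toMaxSubgroup_of_jequiv (hS : IsRightRegularBandOfGroups S) {e : Idem S} {f : S}
    (hf : IsIdempotentElem f)
    (h : JEquiv f e.1) : toMaxSubgroup e f = 1 := by
  refine MaxSubgroup.toS_injective ?_
  rw [hS.toS_toMaxSubgroup (jequiv_iff.1 h).2, MaxSubgroup.toS_one]
  exact (hS.jle_idem_iff hf).1 (jequiv_iff.1 h).2

end IsRightRegularBandOfGroups

end RightIdeals

/-! ### Right kS-modules through the action of S. -/

section RightModules

variable (k : Type v) [Field k] {S : Type u} [Monoid S]

/-- The element `s` of `kS`, as a scalar for right `kS`-modules. -/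
abbrev rsingle (s : S) : (MonoidAlgebra k S)ᵐᵒᵖ := op (MonoidAlgebra.single s 1)

variable {k} {M : Type*} [AddCommGroup M] [Module (MonoidAlgebra k S)ᵐᵒᵖ M]

theorem rsingle_one_smul (m : M) : rsingle k (1 : S) • m = m :=
  one_smul (MonoidAlgebra k S)ᵐᵒᵖ m

theorem rsingle_mul_smul (s t : S) (m : M) :
    rsingle k (s * t) • m = rsingle k t • rsingle k s • m := by
  rw [smul_smul, ← MulOpposite.op_mul, MonoidAlgebra.single_mul_single, mul_one]

variable [Module k M] [IsScalarTower k (MonoidAlgebra k S)ᵐᵒᵖ M]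

theorem op_single_smul (s : S) (c : k) (m : M) :
    op (MonoidAlgebra.single s c) • m = c • rsingle k s • m := by
  rw [← smul_assoc, rsingle, ← MulOpposite.op_smul, MonoidAlgebra.smul_single, smul_eq_mul,
    mul_one]

variable {N : Type*} [AddCommGroup N] [Module (MonoidAlgebra k S)ᵐᵒᵖ N]
  [Module k N] [IsScalarTower k (MonoidAlgebra k S)ᵐᵒᵖ N]

/-- A `k`-linear map commuting with the right action of `S` is `kS`-linear. -/
def extendScalars (f : M →ₗ[k] N) (h : ∀ (s : S) m, f (rsingle k s • m) = rsingle k s • f m) :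
    M →ₗ[(MonoidAlgebra k S)ᵐᵒᵖ] N where
  toFun := f
  map_add' := f.map_add
  map_smul' a m := by
    obtain ⟨a, rfl⟩ := MulOpposite.op_surjective a
    rw [RingHom.id_apply]
    induction a using MonoidAlgebra.induction_linear with
    | zero => simp
    | add x y hx hy => rw [MulOpposite.op_add, add_smul, add_smul, map_add, hx, hy]
    | single s c => rw [op_single_smul s c m, op_single_smul s c (f m), map_smul, h]

theorem extendScalars_apply (f : M →ₗ[k] N) (h) (m : M) :
    extendScalars (S := S) f h m = f m := rfl

end RightModules

/-! ### Generators and relations for the induced modules. -/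

section Induced

variable {k : Type v} [Field k] {S : Type u} [Monoid S]

theorem single_mul_mem_cornerIdeal (e : Idem S) (x : MonoidAlgebra k S) :
    MonoidAlgebra.single e.1 1 * x ∈ cornerIdeal k e := by
  rw [mem_cornerIdeal_iff, ← mul_assoc, MonoidAlgebra.single_mul_single, e.2.eq, mul_one]

namespace IndBimodule

/-- The image of `ex` in `e(kS/kI)`. -/
def ofAlgebra (e : Idem S) : MonoidAlgebra k S →ₗ[k] IndBimodule k e where
  toFun x := IndBimodule.mk k e ⟨MonoidAlgebra.single e.1 1 * x, single_mul_mem_cornerIdeal e x⟩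
  map_add' x y := by
    rw [← map_add]
    exact congrArg _ (Subtype.ext (mul_add _ _ _))
  map_smul' c x := by
    refine congrArg (Submodule.Quotient.mk) (Subtype.ext ?_)
    exact mul_smul_comm c _ x

theorem ofAlgebra_surjective (e : Idem S) :
    Function.Surjective (ofAlgebra (k := k) e) := by
  intro m
  obtain ⟨x, rfl⟩ := Submodule.Quotient.mk_surjective _ m
  exact ⟨x.1, congrArg (Submodule.Quotient.mk) (Subtype.ext (mem_cornerIdeal_iff.1 x.2))⟩

theorem op_smul_ofAlgebra (e : Idem S) (a x : MonoidAlgebra k S) :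
    op a • ofAlgebra e x = ofAlgebra e (x * a) := by
  refine congrArg (Submodule.Quotient.mk) (Subtype.ext ?_)
  exact mul_assoc _ _ _

theorem single_smul (e : Idem S) (g : MaxSubgroup e) (c : k) (m : IndBimodule k e) :
    (MonoidAlgebra.single g c : MonoidAlgebra k (MaxSubgroup e)) • m = c • leftMul k g m := by
  change (MonoidAlgebra.lift k (Module.End (MonoidAlgebra k S)ᵐᵒᵖ (IndBimodule k e))
    (MaxSubgroup e) (leftMulHom k e)) (MonoidAlgebra.single g c) m = _
  rw [MonoidAlgebra.lift_single]
  rfl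

theorem smul_comm_op (e : Idem S) (b : MonoidAlgebra k (MaxSubgroup e)) (a : MonoidAlgebra k S)
    (m : IndBimodule k e) : op a • b • m = b • op a • m :=
  ((MonoidAlgebra.lift k (Module.End (MonoidAlgebra k S)ᵐᵒᵖ (IndBimodule k e))
    (MaxSubgroup e) (leftMulHom k e) b).map_smul (op a) m).symm

theorem leftMul_ofAlgebra (e : Idem S) (g : MaxSubgroup e) (x : MonoidAlgebra k S) :
    leftMul k g (ofAlgebra e x) = ofAlgebra e (MonoidAlgebra.single g.toS 1 * x) := by
  refine congrArg (Submodule.Quotient.mk) (Subtype.ext ?_)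
  change MonoidAlgebra.single g.toS 1 * (MonoidAlgebra.single e.1 1 * x) =
    MonoidAlgebra.single e.1 1 * (MonoidAlgebra.single g.toS 1 * x)
  rw [← mul_assoc, ← mul_assoc, MonoidAlgebra.single_mul_single, MonoidAlgebra.single_mul_single,
    g.toS_mul_idem, g.mul_toS]

theorem ofAlgebra_single_of_not_jle (e : Idem S) {s : S} (h : ¬ JLe e.1 s) (c : k) :
    ofAlgebra e (MonoidAlgebra.single s c) = 0 := by
  refine (Submodule.Quotient.mk_eq_zero _).2 ?_
  change MonoidAlgebra.single e.1 1 * MonoidAlgebra.single s c ∈ notUpIdeal k e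
  have hc : MonoidAlgebra.single (e.1 * s) c = c • MonoidAlgebra.single (e.1 * s) (1 : k) := by simp
  rw [MonoidAlgebra.single_mul_single, one_mul, hc]
  exact Submodule.smul_of_tower_mem _ c
    (Submodule.subset_span ⟨_, fun h' => h (h'.trans (mul_jle_right _ _)), rfl⟩)

theorem ofAlgebra_idem_mul (e : Idem S) (x : MonoidAlgebra k S) :
    ofAlgebra e (MonoidAlgebra.single e.1 1 * x) = ofAlgebra e x := by
  refine congrArg (Submodule.Quotient.mk) (Subtype.ext ?_)
  change MonoidAlgebra.single e.1 1 * (MonoidAlgebra.single e.1 1 * x) = _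
  rw [← mul_assoc, MonoidAlgebra.single_mul_single, e.2.eq, mul_one]

section lift

variable (e : Idem S) {Y : Type*} [AddCommGroup Y] [Module k Y] (β : S → Y)

/-- The `k`-linear map from `kS` with prescribed values on `S`. -/
def fromAlgebra : MonoidAlgebra k S →ₗ[k] Y :=
  Finsupp.linearCombination k β ∘ₗ (MonoidAlgebra.coeffLinearEquiv k).toLinearMap

theorem fromAlgebra_single (s : S) (c : k) :
    fromAlgebra (k := k) β (MonoidAlgebra.single s c) = c • β s := by
  simp [fromAlgebra]

theorem fromAlgebra_eq_zero (h0 : ∀ s, ¬ JLe e.1 s → β s = 0) {x : MonoidAlgebra k S}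
    (hx : x ∈ notUpIdeal k e) : fromAlgebra (k := k) β x = 0 := by
  refine Submodule.closure_induction (p := fun x _ => fromAlgebra (k := k) β x = 0)
    (map_zero _) (fun x y _ _ hx hy => by rw [map_add, hx, hy, add_zero]) ?_ hx
  rintro r _ ⟨s, hs, rfl⟩
  obtain ⟨a, rfl⟩ := MulOpposite.op_surjective r
  rw [op_smul_eq_mul]
  induction a using MonoidAlgebra.induction_linear with
  | zero => simp
  | add x y hx hy => rw [mul_add, map_add, hx, hy, add_zero]
  | single t c =>
    rw [MonoidAlgebra.single_mul_single, fromAlgebra_single,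
      h0 _ fun h => hs (h.trans (mul_jle_left _ _)), smul_zero]

/-- The `k`-linear map from `e(kS/kI)` with prescribed values on `S`. -/
def lift (h0 : ∀ s, ¬ JLe e.1 s → β s = 0) : IndBimodule k e →ₗ[k] Y :=
  (((notUpIdeal k e).submoduleOf (cornerIdeal k e)).restrictScalars k).liftQ
    (fromAlgebra β ∘ₗ (cornerIdeal k e).subtype.restrictScalars k)
    (fun _ hx => fromAlgebra_eq_zero e β h0 hx) ∘ₗ
  (Submodule.Quotient.restrictScalarsEquiv k _).symm.toLinearMap

theorem lift_ofAlgebra (h0 : ∀ s, ¬ JLe e.1 s → β s = 0) (he : ∀ s, β (e.1 * s) = β s)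
    (x : MonoidAlgebra k S) : lift e β h0 (ofAlgebra e x) = fromAlgebra β x := by
  change fromAlgebra β (MonoidAlgebra.single e.1 1 * x) = _
  induction x using MonoidAlgebra.induction_linear with
  | zero => simp
  | add x y hx hy => rw [mul_add, map_add, hx, hy, map_add]
  | single t c =>
    rw [MonoidAlgebra.single_mul_single, fromAlgebra_single, fromAlgebra_single, he, one_mul]

end lift

end IndBimodule

namespace Ind

variable (e : Idem S) {V : Type w} [AddCommGroup V] [Module k V]
  [Module (MonoidAlgebra k (MaxSubgroup e))ᵐᵒᵖ V]

/-- The element `v ⊗ es` of `Ind_e(V)`. -/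
def tmk (s : S) : V →ₗ[k] Ind k e V where
  toFun v := Submodule.Quotient.mk
    (IndBimodule.ofAlgebra e (MonoidAlgebra.single s (1 : k)) ⊗ₜ[k] v)
  map_add' v w := by rw [TensorProduct.tmul_add]; rfl
  map_smul' c v := by rw [TensorProduct.tmul_smul]; rfl

theorem rsingle_smul_tmk (s t : S) (v : V) :
    rsingle k t • tmk (k := k) e s v = tmk e (s * t) v := by
  change Submodule.Quotient.mk
    ((rsingle k t • IndBimodule.ofAlgebra e (MonoidAlgebra.single s (1 : k))) ⊗ₜ[k] v) = _
  rw [IndBimodule.op_smul_ofAlgebra, MonoidAlgebra.single_mul_single, mul_one]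
  rfl

theorem tmk_of_not_jle {s : S} (h : ¬ JLe e.1 s) (v : V) : tmk (k := k) e s v = 0 := by
  change Submodule.Quotient.mk
    (IndBimodule.ofAlgebra e (MonoidAlgebra.single s (1 : k)) ⊗ₜ[k] v) = _
  rw [IndBimodule.ofAlgebra_single_of_not_jle e h, TensorProduct.zero_tmul]
  rfl

theorem tmk_idem_mul (s : S) (v : V) : tmk (k := k) e (e.1 * s) v = tmk e s v := by
  change Submodule.Quotient.mk
    (IndBimodule.ofAlgebra e (MonoidAlgebra.single (e.1 * s) (1 : k)) ⊗ₜ[k] v) = _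
  rw [← mul_one (1 : k), ← MonoidAlgebra.single_mul_single, IndBimodule.ofAlgebra_idem_mul]
  rfl

theorem tmk_toS_mul (g : MaxSubgroup e) (s : S) (v : V) :
    tmk (k := k) e (g.toS * s) v = tmk e s (rsingle k g • v) := by
  symm
  refine (Submodule.Quotient.eq _).2 (Submodule.subset_span ⟨v, MonoidAlgebra.single g 1,
    IndBimodule.ofAlgebra e (MonoidAlgebra.single s 1), ?_⟩)
  rw [IndBimodule.single_smul, one_smul, IndBimodule.leftMul_ofAlgebra,
    MonoidAlgebra.single_mul_single, mul_one]

variable {e} in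
theorem induction_on {motive : Ind k e V → Prop} (x : Ind k e V)
    (add : ∀ x y, motive x → motive y → motive (x + y))
    (mk : ∀ s v, motive (tmk (k := k) e s v)) : motive x := by
  have zero : motive 0 := by
    have := mk e.1 0
    rwa [map_zero] at this
  obtain ⟨z, rfl⟩ := Submodule.Quotient.mk_surjective _ x
  induction z using TensorProduct.induction_on with
  | zero => exact zero
  | add x y hx hy => exact add _ _ hx hy
  | tmul m v =>
    obtain ⟨y, rfl⟩ := IndBimodule.ofAlgebra_surjective e m
    induction y using MonoidAlgebra.induction_linear with
    | zero => rw [map_zero, TensorProduct.zero_tmul]; exact zero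
    | add x y hx hy => rw [map_add, TensorProduct.add_tmul]; exact add _ _ hx hy
    | single s c =>
      have : MonoidAlgebra.single s c = c • MonoidAlgebra.single s (1 : k) := by simp
      rw [this, map_smul, TensorProduct.smul_tmul]
      exact mk s (c • v)

section lift

variable [IsScalarTower k (MonoidAlgebra k (MaxSubgroup e))ᵐᵒᵖ V]
  {X : Type*} [AddCommGroup X] [Module k X] (β : S → V →ₗ[k] X)

theorem lift_balanced (h0 : ∀ s, ¬ JLe e.1 s → β s = 0)
    (hg : ∀ (g : MaxSubgroup e) s v, β (g.toS * s) v = β s (rsingle k g • v))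
    (he : ∀ s, β (e.1 * s) = β s) (v : V)
    (b : MonoidAlgebra k (MaxSubgroup e)) (m : IndBimodule k e) :
    IndBimodule.lift e β h0 (b • m) v = IndBimodule.lift e β h0 m (op b • v) := by
  obtain ⟨x, rfl⟩ := IndBimodule.ofAlgebra_surjective e m
  induction b using MonoidAlgebra.induction_linear with
  | zero => simp
  | add a b ha hb =>
    rw [add_smul, map_add, LinearMap.add_apply, ha, hb, MulOpposite.op_add, add_smul, map_add]
  | single g c =>
    rw [IndBimodule.single_smul, op_single_smul, map_smul, map_smul, LinearMap.smul_apply,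
      IndBimodule.leftMul_ofAlgebra, IndBimodule.lift_ofAlgebra e β h0 he,
      IndBimodule.lift_ofAlgebra e β h0 he]
    congr 1
    induction x using MonoidAlgebra.induction_linear with
    | zero => simp
    | add x y hx hy => rw [mul_add, map_add, map_add, LinearMap.add_apply, hx, hy,
        LinearMap.add_apply]
    | single s c =>
      rw [MonoidAlgebra.single_mul_single, IndBimodule.fromAlgebra_single,
        IndBimodule.fromAlgebra_single, one_mul, LinearMap.smul_apply, LinearMap.smul_apply, hg]

/-- As a vector space, Ind_e(V) is generated by the v ⊗ es, subject only to linearity in v,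
vanishing on I and balancing over G_e. Invariance under e is the balancing relation at the unit of
G_e. -/
theorem exists_lift (h0 : ∀ s, ¬ JLe e.1 s → β s = 0)
    (hg : ∀ (g : MaxSubgroup e) s v, β (g.toS * s) v = β s (rsingle k g • v)) :
    ∃ L : Ind k e V →ₗ[k] X, ∀ s v, L (tmk e s v) = β s v := by
  have he : ∀ s, β (e.1 * s) = β s := fun s => LinearMap.ext fun v =>
    (hg 1 s v).trans (by rw [rsingle_one_smul])
  let F : IndBimodule k e ⊗[k] V →ₗ[k] X := TensorProduct.lift (IndBimodule.lift e β h0)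
  let p : Submodule (MonoidAlgebra k S)ᵐᵒᵖ (IndBimodule k e ⊗[k] V) := Submodule.span _
    {z | ∃ (v : V) (b : MonoidAlgebra k (MaxSubgroup e)) (m : IndBimodule k e),
      z = m ⊗ₜ[k] (op b • v) - (b • m) ⊗ₜ[k] v}
  have hF : p.restrictScalars k ≤ LinearMap.ker F := by
    intro z hz
    refine Submodule.closure_induction (p := fun z _ => F z = 0)
      (map_zero _) (fun x y _ _ hx hy => by rw [map_add, hx, hy, add_zero]) ?_ hz
    rintro r _ ⟨v, b, m, rfl⟩
    obtain ⟨a, rfl⟩ := MulOpposite.op_surjective r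
    rw [smul_sub, TensorProduct.smul_tmul', TensorProduct.smul_tmul', IndBimodule.smul_comm_op,
      map_sub, TensorProduct.lift.tmul, TensorProduct.lift.tmul, lift_balanced e β h0 hg he,
      sub_self]
  refine ⟨(p.restrictScalars k).liftQ F hF ∘ₗ
    (Submodule.Quotient.restrictScalarsEquiv k p).symm.toLinearMap, fun s v => ?_⟩
  change IndBimodule.lift (k := k) e β h0
    (IndBimodule.ofAlgebra e (MonoidAlgebra.single s (1 : k))) v = _
  rw [IndBimodule.lift_ofAlgebra e β h0 he, IndBimodule.fromAlgebra_single, one_smul]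

end lift

theorem hom_ext {X : Type*} [AddCommGroup X] [Module k X] {f g : Ind k e V →ₗ[k] X}
    (h : ∀ s v, f (tmk e s v) = g (tmk e s v)) : f = g :=
  LinearMap.ext fun x => induction_on (motive := fun x => f x = g x) x
    (fun x y hx hy => by rw [map_add, map_add, hx, hy]) h

end Ind

end Induced

/-! ### Splittings, and Möbius inversion of trace functions. -/

section Splitting

variable {k : Type v} [Field k] {S : Type u} [Monoid S]

variable (k) in
/-- The `k`-span in `kS` of a subset of `S`. -/
def setSpan (I : Set S) : Submodule k (MonoidAlgebra k S) :=
  Submodule.span k ((fun s => MonoidAlgebra.single s 1) '' I)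

theorem setSpan_mono {I J : Set S} (h : I ⊆ J) : setSpan k I ≤ setSpan k J :=
  Submodule.span_mono (Set.image_mono h)

theorem mul_single_mem_setSpan {I J : Set S} {t : S} (h : ∀ s ∈ I, s * t ∈ J)
    {x : MonoidAlgebra k S} (hx : x ∈ setSpan k I) :
    x * MonoidAlgebra.single t 1 ∈ setSpan k J := by
  induction hx using Submodule.span_induction with
  | mem x hx =>
    obtain ⟨s, hs, rfl⟩ := hx
    rw [MonoidAlgebra.single_mul_single, mul_one]
    exact Submodule.subset_span ⟨_, h s hs, rfl⟩
  | zero => rw [zero_mul]; exact zero_mem _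
  | add x y _ _ hx hy => rw [add_mul]; exact add_mem hx hy
  | smul c x _ hx => rw [smul_mul_assoc]; exact Submodule.smul_mem _ c hx

theorem op_smul_eq_zero {M : Type*} [AddCommGroup M] [Module (MonoidAlgebra k S)ᵐᵒᵖ M]
    [Module k M] [IsScalarTower k (MonoidAlgebra k S)ᵐᵒᵖ M] {I : Set S} {m : M}
    (h : ∀ s ∈ I, rsingle k s • m = 0) {x : MonoidAlgebra k S} (hx : x ∈ setSpan k I) :
    op x • m = 0 := by
  induction hx using Submodule.span_induction with
  | mem x hx =>
    obtain ⟨s, hs, rfl⟩ := hx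
    exact h s hs
  | zero => simp
  | add x y _ _ hx hy => rw [MulOpposite.op_add, add_smul, hx, hy, add_zero]
  | smul c x _ hx => rw [MulOpposite.op_smul, smul_assoc, hx, smul_zero]

theorem mul_eq_zero_of_mem_setSpan {I : Set S} {a : MonoidAlgebra k S}
    (h : ∀ s ∈ I, a * MonoidAlgebra.single s 1 = 0) {x : MonoidAlgebra k S}
    (hx : x ∈ setSpan k I) : a * x = 0 :=
  op_smul_eq_zero (M := MonoidAlgebra k S) h hx

/-- Elements `η` of `kS` for which `x ↦ ηx` induces a section of the projection
`ekS → e(kS/kI)`, where `I = {s | e ≰_J s}`. -/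
structure IsSplitting (e : Idem S) (η : MonoidAlgebra k S) : Prop where
  mul_idem : η * MonoidAlgebra.single e.1 1 = η
  mul_single : ∀ s, ¬ JLe e.1 s → η * MonoidAlgebra.single s 1 = 0
  sub_mem : η - MonoidAlgebra.single e.1 1 ∈ setSpan k {s | ¬ JLe e.1 s}

namespace IsSplitting

variable {e : Idem S} {η : MonoidAlgebra k S}

theorem op_smul_eq_self (h : IsSplitting e η) {M : Type*} [AddCommGroup M]
    [Module (MonoidAlgebra k S)ᵐᵒᵖ M] [Module k M] [IsScalarTower k (MonoidAlgebra k S)ᵐᵒᵖ M]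
    {m : M} (h1 : rsingle k e.1 • m = m) (h0 : ∀ s, ¬ JLe e.1 s → rsingle k s • m = 0) :
    op η • m = m := by
  have := op_smul_eq_zero h0 h.sub_mem
  rwa [MulOpposite.op_sub, sub_smul, sub_eq_zero, h1] at this

/-- The difference η - e is in kI, which α annihilates. -/
theorem mul_eq (h : IsSplitting e η) {α : MonoidAlgebra k S}
    (h0 : ∀ s, ¬ JLe e.1 s → α * MonoidAlgebra.single s 1 = 0) :
    α * η = α * MonoidAlgebra.single e.1 1 := by
  have := mul_eq_zero_of_mem_setSpan h0 h.sub_mem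
  rwa [mul_sub, sub_eq_zero] at this

/-- A trace function does not depend on the choice of the splitting. -/
theorem trace_mul_single {α : MonoidAlgebra k S} (hα : IsSplitting e α) (hη : IsSplitting e η)
    (τ : MonoidAlgebra k S →ₗ[k] k) (hτ : ∀ x y, τ (x * y) = τ (y * x)) (s : S) :
    τ (α * MonoidAlgebra.single s 1) = τ (η * MonoidAlgebra.single s 1) := by
  have h1 : α * η = α := by rw [hη.mul_eq hα.mul_single, hα.mul_idem]
  have h2 : η * MonoidAlgebra.single s 1 * α =
      η * MonoidAlgebra.single s 1 * MonoidAlgebra.single e.1 1 := by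
    refine hα.mul_eq fun t ht => ?_
    rw [mul_assoc, MonoidAlgebra.single_mul_single, mul_one]
    exact hη.mul_single _ fun h => ht (h.trans (mul_jle_right _ _))
  have h3 : η * MonoidAlgebra.single s 1 * η =
      η * MonoidAlgebra.single s 1 * MonoidAlgebra.single e.1 1 := by
    refine hη.mul_eq fun t ht => ?_
    rw [mul_assoc, MonoidAlgebra.single_mul_single, mul_one]
    exact hη.mul_single _ fun h => ht (h.trans (mul_jle_right _ _))
  have h4 : η * η = η := by rw [hη.mul_eq hη.mul_single, hη.mul_idem]
  -- Insert η through α = αη and rotate. As ηs annihilates I, it cannot distinguish α, e and η on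
  -- its right; rotating once more leaves ηηs = ηs.
  calc τ (α * MonoidAlgebra.single s 1) = τ (η * MonoidAlgebra.single s 1 * α) := by
        rw [← h1, mul_assoc, hτ, h1]
    _ = τ (η * MonoidAlgebra.single s 1) := by rw [h2, ← h3, hτ, ← mul_assoc, h4]

end IsSplitting

section Transversal

variable {n : ℕ} {e : Fin n → Idem S}

theorem IsJTransversal.eq (he : IsJTransversal e) {i j : Fin n} (hij : JLe (e i).1 (e j).1)
    (hji : JLe (e j).1 (e i).1) : i = j :=
  (he (e i).1).unique rfl (jequiv_iff.2 ⟨hij, hji⟩)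

theorem IsJTransversal.exists_jequiv (he : IsJTransversal e) (s : S) :
    ∃ i, JEquiv s (e i).1 := (he s).exists

/-- If s is not above e_j, then e_j s is strictly below e_j, so its class is in U and A annihilates
it. Modulo kI, A e_j is e_j: the error (A - 1)e_j is a combination of products te_j with t below a
class of U, and such a product above e_j would force j into U. -/
theorem isSplitting_mul_idem (he : IsJTransversal e)
    {U : Finset (Fin n)} {j : Fin n} (hj : j ∉ U)
    (hU : ∀ i ∈ U, ∀ m, JLe (e m).1 (e i).1 → m ∈ U)
    (hjU : ∀ m, JLe (e m).1 (e j).1 → m ≠ j → m ∈ U) {A : MonoidAlgebra k S}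
    (hA : A - 1 ∈ setSpan k {s | ∃ i ∈ U, JLe s (e i).1})
    (hA0 : ∀ i ∈ U, ∀ s, JLe s (e i).1 → A * MonoidAlgebra.single s 1 = 0) :
    IsSplitting (e j) (A * MonoidAlgebra.single (e j).1 1) where
  mul_idem := by rw [mul_assoc, MonoidAlgebra.single_mul_single, (e j).2.eq, mul_one]
  mul_single s hs := by
    rw [mul_assoc, MonoidAlgebra.single_mul_single, mul_one]
    obtain ⟨m, hm⟩ := he.exists_jequiv ((e j).1 * s)
    rw [jequiv_iff] at hm
    refine hA0 m (hjU m (hm.2.trans (mul_jle_left _ _)) ?_) _ hm.1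
    rintro rfl
    exact hs (hm.2.trans (mul_jle_right _ _))
  sub_mem := by
    rw [← one_mul (MonoidAlgebra.single (e j).1 1), ← mul_assoc, mul_one, ← sub_mul]
    refine mul_single_mem_setSpan ?_ hA
    rintro t ⟨i, hi, ht⟩ h
    exact hj (hU i hi j ((h.trans (mul_jle_left _ _)).trans ht))

/-- For a set `U` of `J`-classes that is closed downwards, there is an element `A` of `kS`
which annihilates the classes of `U` and acts as the identity modulo them; a trace function is the
sum of its restrictions along `A` and along the splittings for `U`. -/
theorem exists_annihilator (hS : IsRightRegularBandOfGroups S) (he : IsJTransversal e)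
    (U : Finset (Fin n)) (hU : ∀ i ∈ U, ∀ m, JLe (e m).1 (e i).1 → m ∈ U) :
    ∃ A : MonoidAlgebra k S, A - 1 ∈ setSpan k {s | ∃ i ∈ U, JLe s (e i).1} ∧
      (∀ i ∈ U, ∀ s, JLe s (e i).1 → A * MonoidAlgebra.single s 1 = 0) ∧
      ∀ (τ : MonoidAlgebra k S →ₗ[k] k), (∀ x y, τ (x * y) = τ (y * x)) →
        ∀ η : Fin n → MonoidAlgebra k S, (∀ j, IsSplitting (e j) (η j)) → ∀ s,
          τ (MonoidAlgebra.single s 1) = τ (A * MonoidAlgebra.single s 1) +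
            ∑ j ∈ U, τ (η j * MonoidAlgebra.single s 1) := by
  classical
  induction hc : U.card generalizing U with
  | zero =>
    obtain rfl := Finset.card_eq_zero.1 hc
    exact ⟨1, by simp, by simp, by simp⟩
  | succ c ih =>
    have hne : U.Nonempty := Finset.card_pos.1 (by omega)
    -- A class of U with the most classes below it is maximal in U, so removing it leaves a
    -- down-set.
    obtain ⟨j, hjU, hmax⟩ := Finset.exists_max_image U
      (fun i => (Finset.univ.filter fun m => JLe (e m).1 (e i).1).card) hne
    have hjmax : ∀ i ∈ U, JLe (e j).1 (e i).1 → i = j := by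
      intro i hi hji
      have hsub : (Finset.univ.filter fun m => JLe (e m).1 (e j).1) ⊆
          Finset.univ.filter fun m => JLe (e m).1 (e i).1 := by
        intro m hm
        simp only [Finset.mem_filter, Finset.mem_univ, true_and] at hm ⊢
        exact hm.trans hji
      have heq := Finset.eq_of_subset_of_card_le hsub (hmax i hi)
      have : i ∈ Finset.univ.filter fun m => JLe (e m).1 (e j).1 := by
        rw [heq]
        simpa using JLe.refl _
      exact he.eq (by simpa using this) hji
    have hU' : ∀ i ∈ U.erase j, ∀ m, JLe (e m).1 (e i).1 → m ∈ U.erase j := by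
      intro i hi m hm
      rw [Finset.mem_erase] at hi ⊢
      refine ⟨?_, hU i hi.2 m hm⟩
      rintro rfl
      exact hi.1 (hjmax i hi.2 hm)
    obtain ⟨A, hA1, hA0, hAτ⟩ := ih (U.erase j) hU' (by rw [Finset.card_erase_of_mem hjU]; omega)
    have hsplit : IsSplitting (e j) (A * MonoidAlgebra.single (e j).1 1) :=
      isSplitting_mul_idem he (Finset.notMem_erase j U) hU'
        (fun m hm hne => Finset.mem_erase.2 ⟨hne, hU j hjU m hm⟩) hA1 hA0
    -- The new annihilator is A(1 - e_j), because e_j is a left identity on everything below it. The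
    -- removed part A e_j is a splitting at e_j, which may be exchanged for η_j under a trace.
    refine ⟨A - A * MonoidAlgebra.single (e j).1 1, ?_, ?_, ?_⟩
    · have h1 : A - A * MonoidAlgebra.single (e j).1 1 - 1 =
          (A - 1) - (A - 1) * MonoidAlgebra.single (e j).1 1 -
            MonoidAlgebra.single (e j).1 1 := by
        rw [sub_mul, one_mul]; abel
      rw [h1]
      have hsub : {s | ∃ i ∈ U.erase j, JLe s (e i).1} ⊆ {s | ∃ i ∈ U, JLe s (e i).1} :=
        fun s ⟨i, hi, hs⟩ => ⟨i, Finset.mem_of_mem_erase hi, hs⟩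
      refine sub_mem (sub_mem (setSpan_mono hsub hA1) (mul_single_mem_setSpan ?_ hA1))
        (Submodule.subset_span ⟨_, ⟨j, hjU, JLe.refl _⟩, rfl⟩)
      rintro s ⟨i, hi, hs⟩
      exact ⟨i, Finset.mem_of_mem_erase hi, (mul_jle_left _ _).trans hs⟩
    · intro i hi s hs
      rw [sub_mul, mul_assoc, MonoidAlgebra.single_mul_single, mul_one]
      rcases eq_or_ne i j with rfl | hij
      · rw [(hS.jle_idem_iff (e i).2).1 hs, sub_self]
      · have hi' := Finset.mem_erase.2 ⟨hij, hi⟩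
        rw [hA0 i hi' s hs, hA0 i hi' _ ((mul_jle_right _ _).trans hs), sub_self]
    · intro τ hτ η hη s
      rw [hAτ τ hτ η hη s, sub_mul, map_sub, hsplit.trace_mul_single (hη j) τ hτ,
        ← Finset.add_sum_erase U _ hjU]
      ring

theorem exists_isSplitting (hS : IsRightRegularBandOfGroups S) (he : IsJTransversal e)
    (i : Fin n) : ∃ η : MonoidAlgebra k S, IsSplitting (e i) η := by
  classical
  let U := (Finset.univ.filter fun m => JLe (e m).1 (e i).1).erase i
  have hmem : ∀ m, m ∈ U ↔ m ≠ i ∧ JLe (e m).1 (e i).1 := by simp [U]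
  have hU : ∀ j ∈ U, ∀ m, JLe (e m).1 (e j).1 → m ∈ U := by
    intro j hj m hm
    rw [hmem] at hj ⊢
    refine ⟨?_, hm.trans hj.2⟩
    rintro rfl
    exact hj.1 (he.eq hj.2 hm)
  obtain ⟨A, hA1, hA0, -⟩ := exists_annihilator (k := k) hS he U hU
  exact ⟨_, isSplitting_mul_idem he (Finset.notMem_erase i _) hU
    (fun m hm hne => (hmem m).2 ⟨hne, hm⟩) hA1 hA0⟩

/-- When U consists of all classes, the annihilator kills every element of S and only the splitting
terms remain. -/
theorem trace_eq_sum (hS : IsRightRegularBandOfGroups S) (he : IsJTransversal e)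
    {τ : MonoidAlgebra k S →ₗ[k] k} (hτ : ∀ x y, τ (x * y) = τ (y * x))
    {η : Fin n → MonoidAlgebra k S} (hη : ∀ j, IsSplitting (e j) (η j)) (s : S) :
    τ (MonoidAlgebra.single s 1) = ∑ j, τ (η j * MonoidAlgebra.single s 1) := by
  obtain ⟨A, -, hA0, h⟩ := exists_annihilator (k := k) hS he Finset.univ (by simp)
  obtain ⟨j, hj⟩ := he.exists_jequiv s
  rw [h τ hτ η hη s, hA0 j (Finset.mem_univ _) s (jequiv_iff.1 hj).1, map_zero, zero_add]

-- Here sS = SsS, so the poset of principal right ideals is the poset of J-classes; the identity is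
-- the defining recursion of μ.
open Classical in
theorem sum_moebius [Finite S] (hS : IsRightRegularBandOfGroups S) (he : IsJTransversal e)
    (j i : Fin n) :
    ∑ m : Fin n with JLe (e j).1 (e m).1 ∧ JLe (e m).1 (e i).1, moebius (e m).1 (e i).1 =
      if j = i then 1 else 0 := by
  let : Fintype (PrincipalRightIdeals S) := Fintype.ofFinite _
  let : LocallyFiniteOrder (PrincipalRightIdeals S) := Fintype.toLocallyFiniteOrder
  have hle : ∀ s t : S, principal s ≤ principal t ↔ JLe s t := by
    intro s t
    change rightIdeal s ⊆ rightIdeal t ↔ _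
    rw [hS.rightIdeal_eq_twoSidedIdeal, hS.rightIdeal_eq_twoSidedIdeal]
    rfl
  have heq : principal (e j).1 = principal (e i).1 ↔ j = i := by
    refine ⟨fun h => he.eq ((hle _ _).1 h.le) ((hle _ _).1 h.ge), ?_⟩
    rintro rfl
    rfl
  rw [← if_congr heq rfl rfl, ← IncidenceAlgebra.sum_Icc_mu_left]
  refine Finset.sum_bij (fun m _ => principal (e m).1) ?_ ?_ ?_ ?_
  · intro m hm
    rw [Finset.mem_filter] at hm
    exact Finset.mem_Icc.2 ⟨(hle _ _).2 hm.2.1, (hle _ _).2 hm.2.2⟩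
  · intro a _ b _ h
    exact he.eq ((hle _ _).1 h.le) ((hle _ _).1 h.ge)
  · rintro ⟨_, s, rfl⟩ hs
    obtain ⟨m, hm⟩ := he.exists_jequiv s
    have hms : principal (e m).1 = principal s :=
      le_antisymm ((hle _ _).2 (jequiv_iff.1 hm).2) ((hle _ _).2 (jequiv_iff.1 hm).1)
    have hs' : principal s ∈ Finset.Icc (principal (e j).1) (principal (e i).1) := hs
    rw [← hms, Finset.mem_Icc, hle, hle] at hs'
    exact ⟨m, by simpa using hs', hms⟩
  · intro m _
    rfl

open Classical in
/-- Möbius inversion: the value of a trace function along a splitting at `e_i`. -/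
theorem trace_splitting_eq [Finite S] (hS : IsRightRegularBandOfGroups S) (he : IsJTransversal e)
    {τ : MonoidAlgebra k S →ₗ[k] k} (hτ : ∀ x y, τ (x * y) = τ (y * x)) {i : Fin n}
    {α : MonoidAlgebra k S} (hα : IsSplitting (e i) α) (s : S) :
    τ (α * MonoidAlgebra.single s 1) = ∑ m : Fin n with JLe (e m).1 (e i).1,
      (moebius (e m).1 (e i).1 : k) * τ (MonoidAlgebra.single (s * (e m).1) 1) := by
  choose η hη using fun j => exists_isSplitting (k := k) hS he j
  -- If e_j ≰ e_m, then η_j annihilates s e_m. Otherwise the factor e_m disappears: under τ one may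
  -- append e_j on the right of η_j t, and e_m e_j = e_j.
  have h1 : ∀ m, τ (MonoidAlgebra.single (s * (e m).1) 1) =
      ∑ j, if JLe (e j).1 (e m).1 then τ (η j * MonoidAlgebra.single s 1) else 0 := by
    intro m
    rw [trace_eq_sum hS he hτ hη]
    refine Finset.sum_congr rfl fun j _ => ?_
    split_ifs with hjm
    · have h3 : ∀ t : S, η j * MonoidAlgebra.single t 1 * η j =
          η j * MonoidAlgebra.single (t * (e j).1) 1 := by
        intro t
        rw [(hη j).mul_eq, mul_assoc, MonoidAlgebra.single_mul_single, mul_one]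
        intro r hr
        rw [mul_assoc, MonoidAlgebra.single_mul_single, mul_one]
        exact (hη j).mul_single _ fun h => hr (h.trans (mul_jle_right _ _))
      have h4 : η j * η j = η j := by rw [(hη j).mul_eq (hη j).mul_single, (hη j).mul_idem]
      have h5 : ∀ t : S, τ (η j * MonoidAlgebra.single t 1) =
          τ (η j * MonoidAlgebra.single (t * (e j).1) 1) := by
        intro t
        rw [← h3, hτ (η j * MonoidAlgebra.single t 1), ← mul_assoc, h4]
      rw [h5, h5 s, mul_assoc s, (hS.jle_idem_iff (e m).2).1 hjm]
    · rw [(hη j).mul_single _ fun h => hjm (h.trans (mul_jle_right _ _)), map_zero]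
  simp_rw [h1, Finset.mul_sum]
  -- After exchanging the sums, the coefficient of the j-th term is the sum of μ over the interval
  -- from J_j to J_i.
  rw [Finset.sum_comm, hα.trace_mul_single (hη i) τ hτ, Finset.sum_eq_single i]
  · have h2 := sum_moebius hS he i i
    rw [if_pos rfl] at h2
    have h2' := congrArg (Int.cast (R := k)) h2
    push_cast at h2'
    simp_rw [mul_ite, mul_zero]
    rw [← Finset.sum_filter, Finset.filter_filter, ← Finset.sum_mul]
    simp_rw [and_comm (a := JLe (e _).1 (e i).1)]
    rw [h2', one_mul]
  · intro j _ hji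
    have h2 := sum_moebius hS he j i
    rw [if_neg hji] at h2
    have h2' := congrArg (Int.cast (R := k)) h2
    push_cast at h2'
    simp_rw [mul_ite, mul_zero]
    rw [← Finset.sum_filter, Finset.filter_filter, ← Finset.sum_mul]
    simp_rw [and_comm (a := JLe (e _).1 (e i).1)]
    rw [h2', zero_mul]
  · simp

end Transversal

end Splitting

/-! ### Traces on Hom spaces and on right modules. -/

section Trace

variable {k : Type*} [Field k] {V W : Type*} [AddCommGroup V] [Module k V]
  [AddCommGroup W] [Module k W]

theorem trace_eq_of_intertwine {X Y : Type*} [AddCommGroup X] [Module k X] [AddCommGroup Y]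
    [Module k Y] {f : X →ₗ[k] X} {g : Y →ₗ[k] Y} (D : X →ₗ[k] Y) (hD : Function.Bijective D)
    (h : D ∘ₗ f = g ∘ₗ D) : LinearMap.trace k X f = LinearMap.trace k Y g := by
  rw [← LinearMap.trace_conj' f (LinearEquiv.ofBijective D hD)]
  congr 1
  refine LinearMap.ext fun y => ?_
  obtain ⟨x, rfl⟩ := (LinearEquiv.ofBijective D hD).surjective y
  rw [LinearEquiv.conj_apply_apply, LinearEquiv.symm_apply_apply]
  exact LinearMap.congr_fun h x

/-- Under V* ⊗ W ≅ Hom(V, W) the operator becomes Aᵗ ⊗ B. -/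
theorem trace_comp_comp [FiniteDimensional k V] [FiniteDimensional k W] (A : V →ₗ[k] V)
    (B : W →ₗ[k] W) :
    LinearMap.trace k (V →ₗ[k] W) (LinearMap.compRight k B ∘ₗ LinearMap.lcomp k W A) =
      LinearMap.trace k V A * LinearMap.trace k W B := by
  have h : dualTensorHom k V W ∘ₗ TensorProduct.map (Module.Dual.transpose (R := k) A) B =
      (LinearMap.compRight k B ∘ₗ LinearMap.lcomp k W A) ∘ₗ dualTensorHom k V W := by
    refine TensorProduct.ext' fun a w => ?_
    ext v
    simp [Module.Dual.transpose_apply]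
  refine (trace_eq_of_intertwine (X := Module.Dual k V ⊗[k] W) (Y := V →ₗ[k] W)
    (dualTensorHom k V W) dualTensorHom_bijective h).symm.trans ?_
  rw [LinearMap.trace_tensorProduct', LinearMap.trace_transpose']

variable {S : Type*} [Monoid S] [Module (MonoidAlgebra k S)ᵐᵒᵖ W]
  [IsScalarTower k (MonoidAlgebra k S)ᵐᵒᵖ W]

variable (k W) in
/-- The trace of the action of an element of `kS` on a right module. -/
def actionTrace : MonoidAlgebra k S →ₗ[k] k :=
  LinearMap.trace k W ∘ₗ (Algebra.lsmul k k W).toLinearMap ∘ₗ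
    (MulOpposite.opLinearEquiv k).toLinearMap

theorem actionTrace_apply (x : MonoidAlgebra k S) :
    actionTrace k W x = LinearMap.trace k W (Algebra.lsmul k k W (op x)) := rfl

theorem actionTrace_mul_comm (x y : MonoidAlgebra k S) :
    actionTrace k W (x * y) = actionTrace k W (y * x) := by
  rw [actionTrace_apply, actionTrace_apply, MulOpposite.op_mul, MulOpposite.op_mul,
    map_mul (Algebra.lsmul k k W), map_mul (Algebra.lsmul k k W), LinearMap.trace_mul_comm]

end Trace

/-! ### Homomorphisms out of induced modules, and projectivity. -/

section Hom

variable (k : Type v) [Field k] {S : Type u} [Monoid S] (e : Idem S)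
  (V : Type w) [AddCommGroup V] [Module k V] [Module (MonoidAlgebra k (MaxSubgroup e))ᵐᵒᵖ V]
  [IsScalarTower k (MonoidAlgebra k (MaxSubgroup e))ᵐᵒᵖ V]
  (N : Type*) [AddCommGroup N] [Module k N] [Module (MonoidAlgebra k S)ᵐᵒᵖ N]
  [IsScalarTower k (MonoidAlgebra k S)ᵐᵒᵖ N]

/-- The `kG_e`-linear maps from `V` to the elements of `Ne` annihilated by `I`, where
`I = {s | e ≰_J s}`. -/
def homSpace : Submodule k (V →ₗ[k] N) where
  carrier := {φ | (∀ (g : MaxSubgroup e) v, φ (rsingle k g • v) = rsingle k g.toS • φ v) ∧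
    ∀ s, ¬ JLe e.1 s → ∀ v, rsingle k s • φ v = 0}
  zero_mem' := by simp
  add_mem' := by
    rintro φ ψ ⟨h1, h2⟩ ⟨h3, h4⟩
    refine ⟨fun g v => ?_, fun s hs v => ?_⟩
    · simp only [LinearMap.add_apply, h1, h3, smul_add]
    · simp only [LinearMap.add_apply, smul_add, h2 s hs, h4 s hs, add_zero]
  smul_mem' := by
    rintro c φ ⟨h1, h2⟩
    refine ⟨fun g v => ?_, fun s hs v => ?_⟩
    · simp only [LinearMap.smul_apply, h1, smul_comm c]
    · simp only [LinearMap.smul_apply, smul_comm _ c, h2 s hs, smul_zero]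

variable {k e V N} in
theorem rsingle_idem_smul_of_mem {φ : V →ₗ[k] N} (h : φ ∈ homSpace k e V N) (v : V) :
    rsingle k e.1 • φ v = φ v := by
  have := h.1 1 v
  rwa [rsingle_one_smul, MaxSubgroup.toS_one, eq_comm] at this

theorem tmk_mem_homSpace : Ind.tmk e e.1 ∈ homSpace k e V (Ind k e V) := by
  refine ⟨fun g v => ?_, fun s hs v => ?_⟩
  · rw [Ind.rsingle_smul_tmk, ← Ind.tmk_toS_mul, g.mul_toS, g.toS_mul_idem]
  · rw [Ind.rsingle_smul_tmk, Ind.tmk_of_not_jle e fun h => hs (h.trans (mul_jle_right _ _))]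

/-- `Hom_{kS}(Ind_e(V), N)` in terms of `V`. -/
def homMap : (Ind k e V →ₗ[(MonoidAlgebra k S)ᵐᵒᵖ] N) →ₗ[k] homSpace k e V N where
  toFun F := ⟨F.restrictScalars k ∘ₗ Ind.tmk e e.1, by
    have h := tmk_mem_homSpace k e V
    refine ⟨fun g v => ?_, fun s hs v => ?_⟩
    · change F _ = _ • F _
      rw [h.1, map_smul]
    · change _ • F _ = _
      rw [← map_smul, h.2 s hs, map_zero]⟩
  map_add' _ _ := rfl
  map_smul' _ _ := rfl

theorem homMap_apply (F : Ind k e V →ₗ[(MonoidAlgebra k S)ᵐᵒᵖ] N) (v : V) :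
    (homMap k e V N F).1 v = F (Ind.tmk e e.1 v) := rfl

theorem homMap_injective : Function.Injective (homMap k e V N) := by
  intro F F' h
  have h' : F.restrictScalars k = F'.restrictScalars k := by
    refine Ind.hom_ext e fun s v => ?_
    change F _ = F' _
    rw [← Ind.tmk_idem_mul, ← Ind.rsingle_smul_tmk, map_smul, map_smul, ← homMap_apply,
      ← homMap_apply, h]
  exact LinearMap.restrictScalars_injective k h'

theorem homMap_surjective : Function.Surjective (homMap k e V N) := by
  rintro ⟨φ, hφ⟩
  -- The value on v ⊗ e is φ(v), so linearity forces v ⊗ es ↦ φ(v)s.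
  obtain ⟨L, hL⟩ := Ind.exists_lift e (fun s => Algebra.lsmul k k N (rsingle k s) ∘ₗ φ)
    (fun s hs => LinearMap.ext fun v => hφ.2 s hs v) (fun g s v => by
      change rsingle k (g.toS * s) • φ v = rsingle k s • φ _
      rw [hφ.1, rsingle_mul_smul])
  refine ⟨extendScalars (S := S) L fun t m => ?_, ?_⟩
  · refine Ind.induction_on (motive := fun m => L (rsingle k t • m) = rsingle k t • L m) m
      (fun x y hx hy => by rw [smul_add, map_add, map_add, hx, hy, smul_add]) fun s v => ?_
    rw [Ind.rsingle_smul_tmk, hL, hL]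
    exact rsingle_mul_smul _ _ _
  · refine Subtype.ext (LinearMap.ext fun v => ?_)
    rw [homMap_apply, extendScalars_apply, hL]
    exact rsingle_idem_smul_of_mem hφ v

/-- `Hom_{kS}(Ind_e(V), N)` in terms of `V`. -/
def homEquiv : (Ind k e V →ₗ[(MonoidAlgebra k S)ᵐᵒᵖ] N) ≃ₗ[k] homSpace k e V N :=
  LinearEquiv.ofBijective (homMap k e V N) ⟨homMap_injective k e V N, homMap_surjective k e V N⟩

variable [Finite S] {k} (η : MonoidAlgebra k S)

/-- The projection of `Hom_k(V, N)` onto `homSpace k e V N` obtained by averaging over `G_e`. -/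
def averageHom : (V →ₗ[k] N) →ₗ[k] (V →ₗ[k] N) :=
  (1 / (Nat.card (MaxSubgroup e) : k)) • ∑ g : MaxSubgroup e,
    LinearMap.compRight k (Algebra.lsmul k k N (op (η * MonoidAlgebra.single g.toS 1))) ∘ₗ
      LinearMap.lcomp k N (Algebra.lsmul k k V (rsingle k g⁻¹))

theorem averageHom_apply (σ : V →ₗ[k] N) (v : V) :
    averageHom e V N η σ v = (1 / (Nat.card (MaxSubgroup e) : k)) • ∑ g : MaxSubgroup e,
      op (η * MonoidAlgebra.single g.toS (1 : k)) • σ (rsingle k g⁻¹ • v) := by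
  simp only [averageHom, LinearMap.smul_apply, LinearMap.sum_apply]
  rfl

variable {η} in
theorem averageHom_mem (hη : IsSplitting e η) (σ : V →ₗ[k] N) :
    averageHom e V N η σ ∈ homSpace k e V N := by
  refine ⟨fun h v => ?_, fun s hs v => ?_⟩
  · rw [averageHom_apply, averageHom_apply,
      smul_comm (rsingle k h.toS) (1 / (Nat.card (MaxSubgroup e) : k))]
    congr 1
    rw [Finset.smul_sum]
    refine Fintype.sum_equiv (Equiv.mulRight h⁻¹) _ _ fun g => ?_
    rw [Equiv.coe_mulRight, ← rsingle_mul_smul, smul_smul (rsingle k h.toS), ← MulOpposite.op_mul,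
      mul_assoc, MonoidAlgebra.single_mul_single, ← MaxSubgroup.toS_mul, inv_mul_cancel_right,
      one_mul, mul_inv_rev, inv_inv]
  · rw [averageHom_apply, smul_comm (rsingle k s) (1 / (Nat.card (MaxSubgroup e) : k)),
      Finset.smul_sum, Finset.sum_eq_zero, smul_zero]
    intro g _
    rw [smul_smul, ← MulOpposite.op_mul, mul_assoc, MonoidAlgebra.single_mul_single, one_mul,
      hη.mul_single _ fun h => hs (h.trans (mul_jle_right _ _)), MulOpposite.op_zero, zero_smul]

variable {η} {V N} in
-- Every summand is already φ(v): η fixes φ(vg⁻¹), and equivariance cancels g against g⁻¹.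
theorem averageHom_eq_self [CharZero k] (hη : IsSplitting e η) {φ : V →ₗ[k] N}
    (hφ : φ ∈ homSpace k e V N) : averageHom e V N η φ = φ := by
  ext v
  have h : ∀ g : MaxSubgroup e, op (η * MonoidAlgebra.single g.toS (1 : k)) •
      φ (rsingle k g⁻¹ • v) = φ v := by
    intro g
    rw [MulOpposite.op_mul, mul_smul, hη.op_smul_eq_self (rsingle_idem_smul_of_mem hφ _)
      fun s hs => hφ.2 s hs _, ← hφ.1, ← rsingle_mul_smul, inv_mul_cancel, rsingle_one_smul]
  rw [averageHom_apply, Finset.sum_congr rfl fun g _ => h g, Finset.sum_const, Finset.card_univ,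
    ← Nat.card_eq_fintype_card, ← Nat.cast_smul_eq_nsmul k, smul_smul, one_div,
    inv_mul_cancel₀ (Nat.cast_ne_zero.2 Nat.card_pos.ne'), one_smul]

/-- The dimension of `Hom_{kS}(Ind_e(V), N)` in terms of characters. -/
theorem finrank_hom_eq [CharZero k] [FiniteDimensional k V] [FiniteDimensional k N]
    (hη : IsSplitting e η) :
    (Module.finrank k (Ind k e V →ₗ[(MonoidAlgebra k S)ᵐᵒᵖ] N) : k) =
      1 / (Nat.card (MaxSubgroup e) : k) * ∑ g : MaxSubgroup e, character k e V g⁻¹ *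
        actionTrace k N (η * MonoidAlgebra.single g.toS 1) := by
  -- In characteristic 0 the trace of a projection is the dimension of its image.
  have hproj : LinearMap.IsProj (homSpace k e V N) (averageHom e V N η) :=
    ⟨averageHom_mem e V N hη, fun φ hφ => averageHom_eq_self e hη hφ⟩
  rw [(homEquiv k e V N).finrank_eq, ← hproj.trace, averageHom, map_smul, map_sum, smul_eq_mul]
  congr 1
  exact Finset.sum_congr rfl fun g _ => trace_comp_comp _ _

/-- Take a k-linear section σ of a surjection f onto Ind_e(V) and average the restriction of σ to V.
The average extends to a kS-map, and since f commutes with averaging, composing with f returns the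
average of v ↦ v ⊗ e, which is that map itself. -/
theorem projective_ind [CharZero k] (hη : IsSplitting e η) :
    Module.Projective (MonoidAlgebra k S)ᵐᵒᵖ (Ind k e V) := by
  refine Module.Projective.of_lifting_property'' fun f hf => ?_
  obtain ⟨σ, hσ⟩ := LinearMap.exists_rightInverse_of_surjective (f.restrictScalars k)
    (LinearMap.range_eq_top.2 hf)
  let φ := averageHom e V _ η (σ ∘ₗ Ind.tmk e e.1)
  obtain ⟨F, hF⟩ := homMap_surjective k e V _ ⟨φ, averageHom_mem e V _ hη _⟩
  refine ⟨F, homMap_injective k e V _ (Subtype.ext (LinearMap.ext fun v => ?_))⟩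
  have hσ' : ∀ x, f (σ x) = x := fun x => LinearMap.congr_fun hσ x
  rw [homMap_apply, homMap_apply, LinearMap.comp_apply, ← homMap_apply, hF, LinearMap.id_apply]
  change f (averageHom e V _ η (σ ∘ₗ Ind.tmk e e.1) v) = _
  conv_rhs => rw [← averageHom_eq_self e hη (tmk_mem_homSpace k e V)]
  rw [averageHom_apply, averageHom_apply, ← LinearMap.restrictScalars_apply k, map_smul, map_sum]
  congr 1
  refine Finset.sum_congr rfl fun g _ => ?_
  rw [LinearMap.restrictScalars_apply, map_smul, LinearMap.comp_apply, hσ']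

end Hom

/-! ### The decomposition of Ind_e(W) over the idempotents in the J-class of e. -/

section Retract

variable {k : Type v} [Field k] {S : Type u} [Monoid S] [Finite S] (e : Idem S)
  (W : Type w) [AddCommGroup W] [Module k W] [Module (MonoidAlgebra k (MaxSubgroup e))ᵐᵒᵖ W]
  [IsScalarTower k (MonoidAlgebra k (MaxSubgroup e))ᵐᵒᵖ W]

-- The predicate p selects G_e-orbits of elements above e. Taking p to be (es)^ω = f gives the
-- projection to the copy of W at f; taking p always true gives an inverse of w ↦ w ⊗ e on
-- Ind_e(W)e.
open Classical in
theorem exists_retraction (hS : IsRightRegularBandOfGroups S) (p : S → Prop)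
    (hp : ∀ (g : MaxSubgroup e) s, JLe e.1 s → (p (g.toS * s) ↔ p s)) :
    ∃ L : Ind k e W →ₗ[k] W, ∀ s w, L (Ind.tmk e s w) =
      if JLe e.1 s ∧ p s then rsingle k (toMaxSubgroup e s) • w else 0 := by
  obtain ⟨L, hL⟩ := Ind.exists_lift e (X := W) (fun s => if JLe e.1 s ∧ p s then
    Algebra.lsmul k k W (rsingle k (toMaxSubgroup e s)) else 0)
    (fun s hs => if_neg fun h => hs h.1) (fun g s v => by
      by_cases hs : JLe e.1 s
      · have hgs : JLe e.1 (g.toS * s) := hS.jle_mul_iff.2 ⟨g.jle_toS, hs⟩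
        by_cases hps : p s
        · rw [if_pos ⟨hgs, (hp g s hs).2 hps⟩, if_pos ⟨hs, hps⟩, hS.toMaxSubgroup_mul g.jle_toS hs,
            hS.toMaxSubgroup_toS]
          exact rsingle_mul_smul _ _ _
        · rw [if_neg fun h => hps ((hp g s hs).1 h.2), if_neg fun h => hps h.2]
          rfl
      · rw [if_neg fun h => hs (h.1.trans (mul_jle_right _ _)), if_neg fun h => hs h.1]
        rfl)
  refine ⟨L, fun s w => ?_⟩
  rw [hL]
  split_ifs <;> rfl

theorem finiteDimensional_ind [FiniteDimensional k W] : FiniteDimensional k (Ind k e W) := by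
  classical
  let : Fintype S := Fintype.ofFinite S
  refine Module.Finite.of_surjective
    (LinearMap.lsum k (fun _ : S => W) k fun s => Ind.tmk (k := k) e s) fun x => ?_
  refine LinearMap.mem_range.1 (Ind.induction_on (motive := fun x => x ∈ LinearMap.range
    (LinearMap.lsum k (fun _ : S => W) k fun s => Ind.tmk (k := k) e s)) x
    (fun _ _ => add_mem) fun s w => ⟨Pi.single s w, ?_⟩)
  rw [LinearMap.lsum_piSingle]

-- Only copies of W that s maps to themselves contribute to the trace. The copy at f goes to the one
-- at (fs)^ω, and when this is f the action on W is by the element fse of G_e.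
open Classical in
theorem actionTrace_ind [Fintype S] [FiniteDimensional k W] (hS : IsRightRegularBandOfGroups S)
    {s : S} (hs : JLe e.1 s) :
    actionTrace k (Ind k e W) (MonoidAlgebra.single s 1) =
      ∑ f : S with IsIdempotentElem f ∧ JEquiv f e.1 ∧ omegaPow (f * s) = f,
        character k e W (toMaxSubgroup e (f * s)) := by
  have := finiteDimensional_ind (k := k) e W
  have hp : ∀ f : S, ∀ (g : MaxSubgroup e) t, JLe e.1 t →
      (omegaPow (e.1 * (g.toS * t)) = f ↔ omegaPow (e.1 * t) = f) := by
    intro f g t ht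
    have h1 : e.1 * (g.toS * t) = g.toS * (e.1 * t) := by
      rw [← mul_assoc, g.mul_toS, ← mul_assoc, g.toS_mul_idem]
    rw [h1, hS.omegaPow_mul (jequiv_iff.2 ⟨g.toS_jle.trans
      (hS.jle_mul_iff.2 ⟨JLe.refl _, ht⟩), (mul_jle_left _ _).trans g.jle_toS⟩)]
  choose π hπ using fun f => exists_retraction (k := k) e W hS
    (fun t => omegaPow (e.1 * t) = f) (hp f)
  have hid : ∑ f : S with IsIdempotentElem f ∧ JEquiv f e.1,
      Ind.tmk e f ∘ₗ π f = LinearMap.id (R := k) (M := Ind k e W) := by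
    refine Ind.hom_ext e fun t w => ?_
    rw [LinearMap.sum_apply, LinearMap.id_apply]
    simp only [LinearMap.comp_apply, hπ]
    by_cases ht : JLe e.1 t
    · have hJ : JEquiv (omegaPow (e.1 * t)) e.1 :=
        (hS.omegaPow_jequiv _).trans (jequiv_iff.2 ⟨mul_jle_left _ _,
          hS.jle_mul_iff.2 ⟨JLe.refl _, ht⟩⟩)
      rw [Finset.sum_eq_single (omegaPow (e.1 * t))]
      -- The group element te moves across the tensor sign, and et(et)^ω = et.
      · rw [if_pos ⟨ht, rfl⟩, ← Ind.tmk_toS_mul, hS.toS_toMaxSubgroup ht, mul_assoc,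
          (hS.jle_idem_iff e.2).1 (jequiv_iff.1 hJ).1]
        have h1 : t * omegaPow (e.1 * t) = t * (e.1 * omegaPow (e.1 * t)) := by
          rw [(hS.jle_idem_iff e.2).1 (jequiv_iff.1 hJ).1]
        rw [← Ind.tmk_idem_mul, ← mul_assoc, hS.mul_omegaPow, Ind.tmk_idem_mul]
      · intro f _ hf
        rw [if_neg fun h => hf h.2.symm, map_zero]
      · intro h
        exact absurd (Finset.mem_filter.2 ⟨Finset.mem_univ _, omegaPow_isIdempotentElem _, hJ⟩) h
    · rw [Ind.tmk_of_not_jle e ht, Finset.sum_eq_zero]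
      intro f _
      rw [if_neg fun h => ht h.1, map_zero]
  have hcomp : (Algebra.lsmul k k (Ind k e W) (rsingle k s) : Module.End k (Ind k e W)) =
      ∑ f : S with IsIdempotentElem f ∧ JEquiv f e.1,
        Ind.tmk e f ∘ₗ (π f ∘ₗ Algebra.lsmul k k (Ind k e W) (rsingle k s)) := by
    refine LinearMap.ext fun x => ?_
    have := LinearMap.congr_fun hid (rsingle k s • x)
    rw [LinearMap.sum_apply] at this ⊢
    exact this.symm
  rw [actionTrace_apply]
  refine (congrArg _ hcomp).trans ?_
  rw [map_sum]
  have hfilter : (Finset.univ.filter fun f : S =>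
      IsIdempotentElem f ∧ JEquiv f e.1 ∧ omegaPow (f * s) = f) =
      (Finset.univ.filter fun f : S => IsIdempotentElem f ∧ JEquiv f e.1).filter
        fun f => omegaPow (f * s) = f := by
    rw [Finset.filter_filter]
    simp only [and_assoc]
  rw [hfilter, Finset.sum_filter _ (fun f : S => character k e W (toMaxSubgroup e (f * s)))]
  refine Finset.sum_congr rfl fun f hf => ?_
  rw [Finset.mem_filter] at hf
  -- Cyclicity moves the f-th trace from Ind_e(W) to W, where the operator is inclusion, action of
  -- s, projection.
  rw [LinearMap.trace_comp_comm']
  have hfs : JLe e.1 (f * s) := hS.jle_mul_iff.2 ⟨(jequiv_iff.1 hf.2.2).2, hs⟩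
  have hefs : e.1 * (f * s) = f * s := by
    rw [← mul_assoc, (hS.jle_idem_iff e.2).1 (jequiv_iff.1 hf.2.2).1]
  have hmap : ∀ w, π f (rsingle k s • Ind.tmk e f w) =
      if omegaPow (f * s) = f then rsingle k (toMaxSubgroup e (f * s)) • w else 0 := by
    intro w
    rw [Ind.rsingle_smul_tmk, hπ, hefs]
    exact if_congr (and_iff_right hfs) rfl rfl
  split_ifs with h
  · refine congrArg _ (LinearMap.ext fun w => ?_)
    exact (hmap w).trans (if_pos h)
  · refine Eq.trans (congrArg _ (LinearMap.ext fun w => ?_)) (map_zero (LinearMap.trace k W))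
    exact (hmap w).trans (if_neg h)

theorem actionTrace_ind_of_not_jle {s : S} (hs : ¬ JLe e.1 s) :
    actionTrace k (Ind k e W) (MonoidAlgebra.single s 1) = 0 := by
  rw [actionTrace_apply]
  refine Eq.trans (congrArg _ (Ind.hom_ext e fun t w => ?_)) (map_zero (LinearMap.trace k _))
  change rsingle k s • Ind.tmk (k := k) e t w = 0
  rw [Ind.rsingle_smul_tmk, Ind.tmk_of_not_jle e fun h => hs (h.trans (mul_jle_right _ _))]

variable (V : Type*) [AddCommGroup V] [Module k V]
  [Module (MonoidAlgebra k (MaxSubgroup e))ᵐᵒᵖ V]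
  [IsScalarTower k (MonoidAlgebra k (MaxSubgroup e))ᵐᵒᵖ V]

/-- Multiplication by e maps Ind_e(W) onto the copy of W at e, with inverse ρ on that copy, and I
annihilates the copy. So the target of the maps in `homSpace` is W as a kG_e-module. -/
theorem exists_hom_equiv (hS : IsRightRegularBandOfGroups S) :
    Nonempty ((V →ₗ[(MonoidAlgebra k (MaxSubgroup e))ᵐᵒᵖ] W) ≃ₗ[k]
      homSpace k e V (Ind k e W)) := by
  obtain ⟨ρ, hρ⟩ := exists_retraction (k := k) e W hS (fun _ => True) (fun _ _ _ => Iff.rfl)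
  classical
  simp only [and_true] at hρ
  have hid := tmk_mem_homSpace k e W
  have hρe : ∀ w, ρ (Ind.tmk e e.1 w) = w := by
    intro w
    rw [hρ, if_pos (JLe.refl _), hS.toMaxSubgroup_of_jequiv e.2 rfl, rsingle_one_smul]
  have hρn : ∀ n : Ind k e W, rsingle k e.1 • n = Ind.tmk e e.1 (ρ n) := by
    intro n
    refine Ind.induction_on (motive := fun n => rsingle k e.1 • n = Ind.tmk e e.1 (ρ n)) n
      (fun x y hx hy => by rw [smul_add, hx, hy, map_add, map_add]) fun s w => ?_
    rw [Ind.rsingle_smul_tmk, hρ]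
    split_ifs with hs
    · rw [← Ind.tmk_toS_mul, MaxSubgroup.toS_mul_idem, hS.toS_toMaxSubgroup hs]
    · rw [map_zero, Ind.tmk_of_not_jle e fun h => hs (h.trans (mul_jle_left _ _))]
  let Φ : (V →ₗ[(MonoidAlgebra k (MaxSubgroup e))ᵐᵒᵖ] W) →ₗ[k] homSpace k e V (Ind k e W) :=
    { toFun := fun ψ => ⟨Ind.tmk e e.1 ∘ₗ ψ.restrictScalars k, by
        refine ⟨fun g v => ?_, fun s hs v => hid.2 s hs _⟩
        change Ind.tmk e e.1 (ψ _) = _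
        rw [map_smul]
        exact hid.1 g _⟩
      map_add' := fun ψ ψ' => Subtype.ext (LinearMap.ext fun v =>
        (Ind.tmk (k := k) e e.1).map_add (ψ v) (ψ' v))
      map_smul' := fun c ψ => Subtype.ext (LinearMap.ext fun v =>
        (Ind.tmk (k := k) e e.1).map_smul c (ψ v)) }
  have hΦ : ∀ ψ v, (Φ ψ).1 v = Ind.tmk e e.1 (ψ v) := fun _ _ => rfl
  refine ⟨LinearEquiv.ofBijective Φ ⟨fun ψ ψ' h => LinearMap.ext fun v => ?_, ?_⟩⟩
  · rw [← hρe (ψ v), ← hρe (ψ' v), ← hΦ, ← hΦ, h]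
  · rintro ⟨φ, hφ⟩
    have hφ' : ∀ v, Ind.tmk e e.1 (ρ (φ v)) = φ v := fun v => by
      rw [← hρn, rsingle_idem_smul_of_mem hφ]
    refine ⟨extendScalars (S := MaxSubgroup e) (ρ ∘ₗ φ) fun g v => ?_,
      Subtype.ext (LinearMap.ext fun v => ?_)⟩
    · rw [LinearMap.comp_apply, LinearMap.comp_apply, hφ.1, ← hφ' v, ← hid.1, hρe, hρe]
    · exact hφ' v

end Retract

/-! ### Schur's lemma, indecomposability and vanishing. -/

section Main

variable {k : Type v} [Field k] {S : Type u} [Monoid S] [Finite S]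

theorem finiteDimensional_of_isSimpleModule {G : Type*} [Monoid G] [Finite G] (V : Type*)
    [AddCommGroup V] [Module k V] [Module (MonoidAlgebra k G)ᵐᵒᵖ V]
    [IsScalarTower k (MonoidAlgebra k G)ᵐᵒᵖ V] [IsSimpleModule (MonoidAlgebra k G)ᵐᵒᵖ V] :
    FiniteDimensional k V := by
  have h1 : Module.Finite k (MonoidAlgebra k G) :=
    Module.Finite.equiv (MonoidAlgebra.coeffLinearEquiv k).symm
  have h2 : Module.Finite k (MonoidAlgebra k G)ᵐᵒᵖ :=
    Module.Finite.equiv (MulOpposite.opLinearEquiv k)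
  exact Module.Finite.trans (MonoidAlgebra k G)ᵐᵒᵖ V

/-- The projection onto N along N' is a scalar c. It is the identity on N and zero on N', so c = 0
forces N = 0 and c ≠ 0 forces N' = 0. -/
theorem indecomposable_of_finrank_end {A P : Type*} [Ring A] [Algebra k A] [AddCommGroup P]
    [Module A P] [Module k P] [IsScalarTower k A P]
    (h : Module.finrank k (Module.End A P) = 1) :
    Nontrivial P ∧ ∀ N N' : Submodule A P, IsCompl N N' → N = ⊥ ∨ N' = ⊥ := by
  have hP : Nontrivial P := by
    by_contra hP
    rw [not_nontrivial_iff_subsingleton] at hP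
    have : Subsingleton (Module.End A P) := ⟨fun f g => LinearMap.ext fun x => Subsingleton.elim _ _⟩
    rw [Module.finrank_zero_of_subsingleton] at h
    exact zero_ne_one h
  refine ⟨hP, fun N N' hN => ?_⟩
  obtain ⟨c, hc⟩ := (finrank_eq_one_iff_of_nonzero' (1 : Module.End A P) one_ne_zero).1 h
    (N.projection N' hN)
  have hc' : ∀ x, N.projection N' hN x = c • x := fun x => (LinearMap.congr_fun hc x).symm
  by_cases hc0 : c = 0
  · left
    refine (Submodule.eq_bot_iff _).2 fun x hx => ?_
    rw [← Submodule.projection_apply_of_mem_left hN hx, hc', hc0, zero_smul]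
  · right
    refine (Submodule.eq_bot_iff _).2 fun x hx => ?_
    have h0 := hc' x
    rw [Submodule.projection_apply_of_mem_right hN hx] at h0
    exact (smul_eq_zero.1 h0.symm).resolve_left hc0

variable (e : Idem S)
  (V : Type*) [AddCommGroup V] [Module k V] [Module (MonoidAlgebra k (MaxSubgroup e))ᵐᵒᵖ V]
  [IsScalarTower k (MonoidAlgebra k (MaxSubgroup e))ᵐᵒᵖ V]
  [IsSimpleModule (MonoidAlgebra k (MaxSubgroup e))ᵐᵒᵖ V]
  (W : Type*) [AddCommGroup W] [Module k W] [Module (MonoidAlgebra k (MaxSubgroup e))ᵐᵒᵖ W]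
  [IsScalarTower k (MonoidAlgebra k (MaxSubgroup e))ᵐᵒᵖ W]
  [IsSimpleModule (MonoidAlgebra k (MaxSubgroup e))ᵐᵒᵖ W]

open Classical in
theorem finrank_hom_ind [IsAlgClosed k] (hS : IsRightRegularBandOfGroups S) :
    Module.finrank k (Ind k e V →ₗ[(MonoidAlgebra k S)ᵐᵒᵖ] Ind k e W) =
      if Nonempty (V ≃ₗ[(MonoidAlgebra k (MaxSubgroup e))ᵐᵒᵖ] W) then 1 else 0 := by
  obtain ⟨Φ⟩ := exists_hom_equiv (k := k) e W V hS
  rw [(homEquiv k e V (Ind k e W)).finrank_eq, ← Φ.finrank_eq]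
  have := finiteDimensional_of_isSimpleModule (k := k) (G := MaxSubgroup e) V
  split_ifs with h
  · obtain ⟨φ⟩ := h
    have h1 := IsSimpleModule.algebraMap_end_bijective_of_isAlgClosed
      (A := (MonoidAlgebra k (MaxSubgroup e))ᵐᵒᵖ) (V := V) k
    have hV : Nontrivial V := IsSimpleModule.nontrivial (MonoidAlgebra k (MaxSubgroup e))ᵐᵒᵖ V
    obtain ⟨v, hv⟩ := exists_ne (0 : V)
    refine finrank_eq_one (φ : V →ₗ[(MonoidAlgebra k (MaxSubgroup e))ᵐᵒᵖ] W) ?_ ?_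
    · intro h0
      have := LinearMap.congr_fun h0 v
      exact hv (φ.map_eq_zero_iff.1 this)
    · intro ψ
      obtain ⟨c, hc⟩ := h1.2 ((φ.symm : W →ₗ[(MonoidAlgebra k (MaxSubgroup e))ᵐᵒᵖ] V) ∘ₗ ψ)
      refine ⟨c, LinearMap.ext fun x => ?_⟩
      have hx : c • x = φ.symm (ψ x) := LinearMap.congr_fun hc x
      change c • φ x = ψ x
      rw [← φ.apply_symm_apply (ψ x), ← hx]
      exact ((φ : V →ₗ[(MonoidAlgebra k (MaxSubgroup e))ᵐᵒᵖ] W).map_smul_of_tower c x).symm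
  · have : Subsingleton (V →ₗ[(MonoidAlgebra k (MaxSubgroup e))ᵐᵒᵖ] W) := by
      refine subsingleton_of_forall_eq 0 fun f => ?_
      refine (LinearMap.bijective_or_eq_zero f).resolve_left fun hf => h ⟨?_⟩
      exact LinearEquiv.ofBijective f hf
    exact Module.finrank_zero_of_subsingleton

theorem isProjectiveIndecomposable_ind [IsAlgClosed k] [CharZero k]
    (hS : IsRightRegularBandOfGroups S) {η : MonoidAlgebra k S} (hη : IsSplitting e η) :
    IsProjectiveIndecomposable (MonoidAlgebra k S) (Ind k e V) := by
  have h1 := finrank_hom_ind (k := k) e V V hS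
  rw [if_pos ⟨LinearEquiv.refl _ _⟩] at h1
  obtain ⟨h2, h3⟩ := indecomposable_of_finrank_end (k := k) h1
  exact ⟨projective_ind e V η hη, h2, h3⟩

/-- There are no homomorphisms between induced modules unless the apexes are comparable. -/
theorem finrank_hom_ind_of_not_jle {e e' : Idem S} (h : ¬ JLe e'.1 e.1)
    (V : Type*) [AddCommGroup V] [Module k V] [Module (MonoidAlgebra k (MaxSubgroup e))ᵐᵒᵖ V]
    [IsScalarTower k (MonoidAlgebra k (MaxSubgroup e))ᵐᵒᵖ V]
    (W : Type*) [AddCommGroup W] [Module k W] [Module (MonoidAlgebra k (MaxSubgroup e'))ᵐᵒᵖ W] :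
    Module.finrank k (Ind k e V →ₗ[(MonoidAlgebra k S)ᵐᵒᵖ] Ind k e' W) = 0 := by
  have : Subsingleton (homSpace k e V (Ind k e' W)) := by
    refine subsingleton_of_forall_eq 0 ?_
    rintro ⟨φ, hφ⟩
    refine Subtype.ext (LinearMap.ext fun v => ?_)
    have h0 : ∀ n : Ind k e' W, rsingle k e.1 • n = 0 := fun n =>
      Ind.induction_on (motive := fun n => rsingle k e.1 • n = 0) n
        (fun x y hx hy => by rw [smul_add, hx, hy, add_zero]) fun s w => by
          rw [Ind.rsingle_smul_tmk, Ind.tmk_of_not_jle _ fun h' => h (h'.trans (mul_jle_right _ _))]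
    exact (rsingle_idem_smul_of_mem hφ v).symm.trans (h0 _)
  rw [(homEquiv k e V (Ind k e' W)).finrank_eq, Module.finrank_zero_of_subsingleton]

theorem sameModule_iff {n : ℕ} {e : Fin n → Idem S} (i : Fin n)
    (V : Type*) [AddCommGroup V] [Module k V]
    [Module (MonoidAlgebra k (MaxSubgroup (e i)))ᵐᵒᵖ V]
    [IsScalarTower k (MonoidAlgebra k (MaxSubgroup (e i)))ᵐᵒᵖ V]
    (W : Type*) [AddCommGroup W] [Module k W]
    [Module (MonoidAlgebra k (MaxSubgroup (e i)))ᵐᵒᵖ W]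
    [IsScalarTower k (MonoidAlgebra k (MaxSubgroup (e i)))ᵐᵒᵖ W] :
    SameModule k e i i V W ↔
      Nonempty (V ≃ₗ[(MonoidAlgebra k (MaxSubgroup (e i)))ᵐᵒᵖ] W) := by
  constructor
  · rintro ⟨-, φ, hφ⟩
    exact ⟨LinearEquiv.ofBijective (extendScalars (S := MaxSubgroup (e i)) φ.toLinearMap
      fun g v => hφ g g rfl v) φ.bijective⟩
  · rintro ⟨φ⟩
    refine ⟨rfl, φ.restrictScalars k, fun g h hgh v => ?_⟩
    rw [MaxSubgroup.toS_injective hgh]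
    exact φ.map_smul _ v

end Main

/-! ### The character formula. -/

section Formula

variable {k : Type v} [Field k] {S : Type u} [Monoid S] [Fintype S] {n : ℕ} {e : Fin n → Idem S}

theorem finrank_hom_eq_cartanFormula [CharZero k] (hS : IsRightRegularBandOfGroups S)
    (he : IsJTransversal e) {i l : Fin n} (hli : JLe (e l).1 (e i).1)
    (V : Type*) [AddCommGroup V] [Module k V]
    [Module (MonoidAlgebra k (MaxSubgroup (e i)))ᵐᵒᵖ V]
    [IsScalarTower k (MonoidAlgebra k (MaxSubgroup (e i)))ᵐᵒᵖ V] [FiniteDimensional k V]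
    (W : Type*) [AddCommGroup W] [Module k W]
    [Module (MonoidAlgebra k (MaxSubgroup (e l)))ᵐᵒᵖ W]
    [IsScalarTower k (MonoidAlgebra k (MaxSubgroup (e l)))ᵐᵒᵖ W] [FiniteDimensional k W] :
    (Module.finrank k (Ind k (e i) V →ₗ[(MonoidAlgebra k S)ᵐᵒᵖ] Ind k (e l) W) : k) =
      cartanFormula k e i l V W := by
  classical
  obtain ⟨η, hη⟩ := exists_isSplitting (k := k) hS he i
  have := finiteDimensional_ind (k := k) (e l) W
  rw [finrank_hom_eq (e i) V _ η hη, cartanFormula]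
  congr 1
  refine Finset.sum_congr rfl fun g _ => ?_
  congr 1
  rw [trace_splitting_eq hS he actionTrace_mul_comm hη]
  have hsub : (Finset.univ.filter fun m : Fin n => JLe (e l).1 (e m).1 ∧ JLe (e m).1 (e i).1) ⊆
      Finset.univ.filter fun m : Fin n => JLe (e m).1 (e i).1 :=
    Finset.monotone_filter_right _ fun m _ hm => hm.2
  -- Classes J_m not above J_ℓ drop out: g e_m is then not above e_ℓ and acts on Ind_ℓ(W) by zero.
  rw [← Finset.sum_subset hsub]
  · refine Finset.sum_congr (by congr) fun m hm => ?_
    have hlm : JLe (e l).1 (e m).1 := (Finset.mem_filter.1 hm).2.1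
    congr 1
    have hlg : JLe (e l).1 (g.toS * (e m).1) := hS.jle_mul_iff.2 ⟨hli.trans g.jle_toS, hlm⟩
    rw [actionTrace_ind (k := k) (e l) W hS hlg]
    have hassoc : ∀ f : S, f * (g.toS * (e m).1) = f * g.toS * (e m).1 := fun f =>
      (mul_assoc _ _ _).symm
    simp_rw [hassoc]
    refine Finset.sum_congr (by congr) fun f hf => ?_
    have hf' := (Finset.mem_filter.1 hf).2
    -- As e_ℓ ≤ e_m, e_m e_ℓ = e_ℓ; the character value therefore does not depend on m.
    have htoS : (toMaxSubgroup (e l) (f * g.toS * (e m).1)).toS = f * g.toS * (e l).1 := by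
      rw [hS.toS_toMaxSubgroup (by
        rw [← hassoc]
        exact hS.jle_mul_iff.2 ⟨(jequiv_iff.1 hf'.2.1).2, hlg⟩), mul_assoc,
        (hS.jle_idem_iff (e m).2).1 hlm]
    rw [← htoS, characterS_toS]
  · intro m hm hm'
    rw [actionTrace_ind_of_not_jle, mul_zero]
    intro h
    exact hm' (Finset.mem_filter.2 ⟨Finset.mem_univ _, h.trans (mul_jle_right _ _),
      (Finset.mem_filter.1 hm).2⟩)

end Formula

end RRBG
end

open RRBG
open Classical in
theorem theorem5p5 {k : Type*} [Field k] [IsAlgClosed k] [CharZero k]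
    {S : Type*} [Monoid S] [Fintype S] (hS : IsRightRegularBandOfGroups S)
    {n : ℕ} (e : Fin n → Idem S) (he : IsJTransversal e) (i l : Fin n)
    (V : Type*) [AddCommGroup V] [Module k V]
    [Module (MonoidAlgebra k (MaxSubgroup (e i)))ᵐᵒᵖ V]
    [IsScalarTower k (MonoidAlgebra k (MaxSubgroup (e i)))ᵐᵒᵖ V]
    [IsSimpleModule (MonoidAlgebra k (MaxSubgroup (e i)))ᵐᵒᵖ V]
    (W : Type*) [AddCommGroup W] [Module k W]
    [Module (MonoidAlgebra k (MaxSubgroup (e l)))ᵐᵒᵖ W]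
    [IsScalarTower k (MonoidAlgebra k (MaxSubgroup (e l)))ᵐᵒᵖ W]
    [IsSimpleModule (MonoidAlgebra k (MaxSubgroup (e l)))ᵐᵒᵖ W] :
    IsProjectiveIndecomposable (MonoidAlgebra k S) (Ind k (e i) V) ∧
    IsProjectiveIndecomposable (MonoidAlgebra k S) (Ind k (e l) W) ∧
    (cartanInvariant k (MonoidAlgebra k S) (Ind k (e i) V) (Ind k (e l) W) : k) =
      if JLt (e l).1 (e i).1 then cartanFormula k e i l V W
      else if SameModule k e i l V W then 1
      else 0 := by
  obtain ⟨η, hη⟩ := exists_isSplitting (k := k) hS he i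
  obtain ⟨η', hη'⟩ := exists_isSplitting (k := k) hS he l
  refine ⟨isProjectiveIndecomposable_ind (e i) V hS hη,
    isProjectiveIndecomposable_ind (e l) W hS hη', ?_⟩
  rw [cartanInvariant]
  split_ifs with h1 h2
  · have := finiteDimensional_of_isSimpleModule (k := k) (G := MaxSubgroup (e i)) V
    have := finiteDimensional_of_isSimpleModule (k := k) (G := MaxSubgroup (e l)) W
    exact finrank_hom_eq_cartanFormula hS he h1.1 V W
  · obtain rfl : i = l := h2.1
    rw [finrank_hom_ind (e i) V W hS, if_pos ((sameModule_iff i V W).1 h2), Nat.cast_one]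
  · by_cases hil : i = l
    · subst hil
      rw [finrank_hom_ind (e i) V W hS, if_neg fun h => h2 ((sameModule_iff i V W).2 h),
        Nat.cast_zero]
    -- Distinct representatives are not J-equivalent, so e_ℓ ≤ e_i would already be strict.
    · rw [finrank_hom_ind_of_not_jle (fun h => h1 ⟨h, fun h' => hil (he.eq h' h)⟩), Nat.cast_zero]
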